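/- \textbf{Conventions.} Squares are pairs $(i,j)$ (row, column), rows numbered downwards and columns to the right. For partitions $\mu\subseteq\lambda$, let $\mathrm{Tab}(\lambda/\mu)$ be the set of skew semistandard tableaux of shape $\lambda/\mu$ with entries in $\mathbb N=\{0,1,2,\dots\}$, weakly increasing along rows and strictly increasing down columns. \emph{Coplactic operations.} Let $i\in\mathbb N$. A word over $\mathbb N$ is \emph{dominant for $i$} if each of its prefixes contains at least as many letters $i$ as letters $i+1$, and \emph{anti-dominant for $i$} if each of its suffixes contains at least as many letters $i+1$ as letters $i$. For words $w=u\,i\,v$ and $w'=u\,(i+1)\,v$ with $u$ anti-dominant for $i$ and $v$ dominant for $i$, one writes $w=e_i(w')$ and $w'=f_i(w)$. A \emph{valid reading order} for $\lambda/\mu$ is a total order $\leq_r$ on its squares such that $(i,j)\leq_r(i',j')$ whenever $i\leq i'$ and $j\geq j'$; $w_r(T)$ is the word of the entries of $T$ listed in increasing order of their squares for $\leq_r$. For $T\in\mathrm{Tab}(\lambda/\mu)$ and $c\in\{e_i,f_i\}$, $c(T)$ is defined and equal to $U$ if $U\in\mathrm{Tab}(\lambda/\mu)$, $c(w_r(T))$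 is defined, and $w_r(U)=c(w_r(T))$, where $\leq_r$ is an arbitrary valid reading order. \emph{Tableau switching.} An inward jeu de taquin slide of $T\in\mathrm{Tab}(\lambda/\mu)$ into a corner square $s$ of $\mu$ starts with the empty square $s$ and repeatedly moves into the empty square the smaller of the entries to the right of it and below it (the one below if they are equal), until there are no such entries. For $S\in\mathrm{Tab}(\mu/\nu)$ and $T\in\mathrm{Tab}(\lambda/\mu)$ one puts $X(S,T)=(T',S')$, where $T'\in\mathrm{Tab}(\mu'/\nu)$ is obtained from $T$ by successive inward slides into the squares of $S$, taken in order of decreasing entries and from right to left among equal entries, and $S'\in\mathrm{Tab}(\lambda/\mu')$ has, in the square vacated by each slide, the entry of $S$ in the square into which that slide was made. \textbf{Theorem (commutation of coplactic operations with jeu de taquin).} Let $S\in\mathrm{Tab}(\mu/\nu)$, $T\in\mathrm{Tab}(\lambda/\mu)$ and $X(S,T)=(T',S')$, and let $i\in\mathbb N$. Then, whichever valid reading orders are used to compute the coplactic operations on $T$ and on $T'$, $e_i(T)$ is defined if and only if $e_i(T')$ is defined, and in that case $$X(S,e_i(T))=(e_i(T'),S').$$ The same holds with $e_i$ replaced by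 $f_i$. -/

import Mathlib

/-!
Squares are pairs `(i, j)` = (row, column), rows numbered downwards and columns to the right,
both from `0`; this is the convention of `YoungDiagram`.  Entries of tableaux are natural numbers.
-/

/-- A skew semistandard tableau of shape `lam / mu`: entries increase weakly along rows and
strictly down columns.  The entry function is normalised to be `0` outside the shape. -/
@[ext]
structure SkewTableau (lam mu : YoungDiagram) where
  le : mu ≤ lam
  entry : ℕ × ℕ → ℕ
  row_weak : ∀ i j₁ j₂, j₁ ≤ j₂ → (i, j₁) ∉ mu → (i, j₂) ∈ lam → entry (i, j₁) ≤ entry (i, j₂)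
  col_strict : ∀ i₁ i₂ j, i₁ < i₂ → (i₁, j) ∉ mu → (i₂, j) ∈ lam → entry (i₁, j) < entry (i₂, j)
  zeros : ∀ s, ¬ (s ∈ lam ∧ s ∉ mu) → entry s = 0

/-! ### Coplactic operations on words -/

/-- Every prefix of `w` contains at least as many letters `i` as letters `i + 1`. -/
def Dominant (i : ℕ) (w : List ℕ) : Prop :=
  ∀ u, u <+: w → u.count (i + 1) ≤ u.count i

/-- Every suffix of `w` contains at least as many letters `i + 1` as letters `i`. -/
def AntiDominant (i : ℕ) (w : List ℕ) : Prop :=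
  ∀ v, v <:+ w → v.count i ≤ v.count (i + 1)

/-- The coplactic transition between `w = u i v` and `w' = u (i+1) v`, where `u` is anti-dominant
and `v` is dominant for `i`.  It means `w = e_i(w')` and `w' = f_i(w)`. -/
def CoplacticStep (i : ℕ) (w w' : List ℕ) : Prop :=
  ∃ u v, w = u ++ i :: v ∧ w' = u ++ (i + 1) :: v ∧ AntiDominant i u ∧ Dominant i v

/-! ### Coplactic operations on tableaux -/

/-- A valid reading order for `lam / mu`, given as the list of the squares in increasing order:
a total order on the squares of `lam / mu` such that `(i, j)` comes weakly before `(i', j')`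
whenever `i ≤ i'` and `j ≥ j'`.  (So if `s` is listed before `t`, then `t` is not forced to come
weakly before `s`.) -/
structure ReadingOrder (lam mu : YoungDiagram) where
  squares : List (ℕ × ℕ)
  nodup : squares.Nodup
  mem_squares : ∀ s, s ∈ squares ↔ s ∈ lam ∧ s ∉ mu
  valid : squares.Pairwise fun s t => ¬ (t.1 ≤ s.1 ∧ s.2 ≤ t.2)

/-- The word `w_r(T)` of entries of `T`, listed in the reading order `r`. -/
def ReadingOrder.word {lam mu : YoungDiagram} (r : ReadingOrder lam mu)
    (T : SkewTableau lam mu) : List ℕ :=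
  r.squares.map T.entry

/-- `e_i(T)`, computed with the reading order `r`, is defined and equal to `U`: the tableau `U`
has the same shape as `T`, and its reading word is `e_i` of the reading word of `T`. -/
def IsRaise {lam mu : YoungDiagram} (r : ReadingOrder lam mu) (i : ℕ)
    (T U : SkewTableau lam mu) : Prop :=
  CoplacticStep i (r.word U) (r.word T)

/-- `f_i(T)`, computed with the reading order `r`, is defined and equal to `U`. -/
def IsLower {lam mu : YoungDiagram} (r : ReadingOrder lam mu) (i : ℕ)
    (T U : SkewTableau lam mu) : Prop :=
  CoplacticStep i (r.word T) (r.word U)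

/-! ### Jeu de taquin and tableau switching -/

/-- A filling of some of the squares of the quadrant; `⊤` marks a square without entry. -/
abbrev Filling := ℕ × ℕ → WithTop ℕ

/-- The filling given by a skew tableau: its entries on its shape, nothing elsewhere. -/
def SkewTableau.filling {lam mu : YoungDiagram} (T : SkewTableau lam mu) : Filling :=
  fun s => if s ∈ lam ∧ s ∉ mu then (T.entry s : WithTop ℕ) else ⊤

/-- `Slide T s T' t`: the inward jeu de taquin slide of `T` into the empty square `s` results in
`T'`, and the square finally vacated is `t`.  At each step the smaller of the entries to the right
of and below the empty square moves into it, where the one below moves if they are equal (it is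
the smaller one in the standardisation); the slide ends when neither square has an entry. -/
inductive Slide : Filling → ℕ × ℕ → Filling → ℕ × ℕ → Prop
  | done (T : Filling) (i j : ℕ) (hright : T (i, j + 1) = ⊤) (hbelow : T (i + 1, j) = ⊤) :
      Slide T (i, j) T (i, j)
  | up (T T' : Filling) (i j : ℕ) (t : ℕ × ℕ) (hne : T (i + 1, j) ≠ ⊤)
      (hle : T (i + 1, j) ≤ T (i, j + 1))
      (next : Slide (Function.update (Function.update T (i, j) (T (i + 1, j))) (i + 1, j) ⊤)
        (i + 1, j) T' t) :
      Slide T (i, j) T' t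
  | left (T T' : Filling) (i j : ℕ) (t : ℕ × ℕ) (hlt : T (i, j + 1) < T (i + 1, j))
      (next : Slide (Function.update (Function.update T (i, j) (T (i, j + 1))) (i, j + 1) ⊤)
        (i, j + 1) T' t) :
      Slide T (i, j) T' t

/-- `s` is the last square of `S` in the order of its standardisation: its entry is maximal, and
it is the rightmost square with that entry. -/
def IsLastSquare (S : Filling) (s : ℕ × ℕ) : Prop :=
  S s ≠ ⊤ ∧ ∀ s', S s' ≠ ⊤ → S s' < S s ∨ (S s' = S s ∧ s'.2 ≤ s.2)

/-- Tableau switching `X(S, T) = (T', S')` on the level of fillings: `T` is slid successively into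
the squares of `S`, taken from the last one to the first one in the order of the standardisation
of `S`, which results in `T'`; the square vacated by each slide receives in `S'` the entry that
`S` has in the square into which that slide was performed. -/
inductive FillingSwitch : Filling → Filling → Filling → Filling → Prop
  | nil (T : Filling) : FillingSwitch (fun _ => ⊤) T T (fun _ => ⊤)
  | step (S T T₁ T' S' : Filling) (s t : ℕ × ℕ) (hs : IsLastSquare S s) (hslide : Slide T s T₁ t)
      (rest : FillingSwitch (Function.update S s ⊤) T₁ T' S') :
      FillingSwitch S T T' (Function.update S' t (S s))

/-- Tableau switching `X(S, T) = (T', S')` for skew semistandard tableaux `S` of shape `mu / nu`,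
`T` of shape `lam / mu`, `T'` of shape `mu' / nu` and `S'` of shape `lam / mu'`. -/
def IsSwitch {nu mu mu' lam : YoungDiagram} (S : SkewTableau mu nu) (T : SkewTableau lam mu)
    (T' : SkewTableau mu' nu) (S' : SkewTableau lam mu') : Prop :=
  FillingSwitch S.filling T.filling T'.filling S'.filling


/-!
A skew tableau `T` is the same thing as the Gelfand–Tsetlin pattern `A`, where `A k` is the shape of
the part of `T` with entries smaller than `k`, together with the inner shape. In these terms a slide
is computed level by level: while the empty square passes the entries `k`, it either stays in its
row or moves down by one row, so that only its row at every level matters, and each level `A k`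
loses the last square of that row.

The operation `f_i` changes only the level `A (i + 1)`. For every reading order, it changes the last
letter `i` of row `p`, where `p` is the last row in which the row height
`#{i + 1 in rows ≤ p} - #{i in rows < p}` is maximal: this number is the height of the reading word
before that letter, and the height of every prefix is bounded by the height of some row. A slide
leaves the row heights unchanged, except that it may increase by one a row height smaller than the
next one, or decrease by one a row height not larger than the preceding one. Hence the last maximum
stays in its row, or moves up by one row exactly when the letter changed by `f_i` is moved up by the
slide. Either way the slide vacates the same square before and after `f_i`, and the theorem follows
by induction on the number of slides.
-/

/-! ### Gelfand–Tsetlin patterns -/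

/-- A Gelfand–Tsetlin pattern of skew shape. It encodes a skew semistandard tableau by the numbers
`A k q` of squares of row `q` that lie in the inner shape or have an entry smaller than `k`, so
that successive levels `A k`, `A (k + 1)` are partitions differing by a horizontal strip. -/
structure IsGTPattern (A : ℕ → ℕ → ℕ) : Prop where
  mono : ∀ k q, A k q ≤ A (k + 1) q
  strip : ∀ k q, A (k + 1) (q + 1) ≤ A k q
  stable : ∃ K, ∀ k, K ≤ k → A k = A K
  supp : ∀ k, ∃ Q, ∀ q, Q ≤ q → A k q = 0

section Pattern

variable {A : ℕ → ℕ → ℕ}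

theorem IsGTPattern.monotone (hA : IsGTPattern A) (q : ℕ) : Monotone fun k => A k q :=
  monotone_nat_of_le_succ fun k => hA.mono k q

theorem IsGTPattern.antitone (hA : IsGTPattern A) (k : ℕ) : Antitone (A k) :=
  antitone_nat_of_succ_le fun q => (hA.mono k (q + 1)).trans (hA.strip k q)

theorem IsGTPattern.update_level (hA : IsGTPattern A) {i : ℕ} {β : ℕ → ℕ}
    (lower : ∀ q, A i q ≤ β q) (upper : ∀ q, β q ≤ A (i + 2) q)
    (strip_lower : ∀ q, β (q + 1) ≤ A i q) (strip_upper : ∀ q, A (i + 2) (q + 1) ≤ β q) :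
    IsGTPattern (Function.update A (i + 1) β) := by
  have level (k : ℕ) (hk : k ≠ i + 1) : Function.update A (i + 1) β k = A k :=
    Function.update_of_ne hk ..
  have level_self : Function.update A (i + 1) β (i + 1) = β := Function.update_self ..
  refine ⟨fun k q => ?_, fun k q => ?_, ?_, fun k => ?_⟩
  · rcases eq_or_ne k i with rfl | hki
    · simpa only [level_self, level k (by omega)] using lower q
    rcases eq_or_ne k (i + 1) with rfl | hki'
    · simpa only [level_self, level (i + 1 + 1) (by omega)] using upper q
    simpa only [level k hki', level (k + 1) (by omega)] using hA.mono k q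
  · rcases eq_or_ne k i with rfl | hki
    · simpa only [level_self, level k (by omega)] using strip_lower q
    rcases eq_or_ne k (i + 1) with rfl | hki'
    · simpa only [level_self, level (i + 1 + 1) (by omega)] using strip_upper q
    simpa only [level k hki', level (k + 1) (by omega)] using hA.strip k q
  · obtain ⟨K, hK⟩ := hA.stable
    refine ⟨max K (i + 2), fun k hk => ?_⟩
    rw [level k (by omega), level _ (by omega), hK k (by omega), hK _ (le_max_left ..)]
  · rcases eq_or_ne k (i + 1) with rfl | hk
    · obtain ⟨Q, hQ⟩ := hA.supp (i + 2)
      refine ⟨Q, fun q hq => Nat.le_zero.1 ?_⟩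
      simpa only [level_self, hQ q hq] using upper q
    · simpa only [level k hk] using hA.supp k

end Pattern

/-! ### The slide of a pattern -/

/-- The row of the empty square of the slide into the corner in row `a` of the inner shape, after
the entries smaller than `k` have been passed: while the entries `k` are passed, the empty square
moves down exactly if the square below it contains `k`, and it moves at most once. -/
def slideRow (A : ℕ → ℕ → ℕ) (a : ℕ) : ℕ → ℕ
  | 0 => a
  | k + 1 =>
    if A (k + 1) (slideRow A a k + 1) = A k (slideRow A a k) then slideRow A a k + 1
    else slideRow A a k

/-- The pattern after the slide into the corner in row `a` of the inner shape. -/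
def slidePattern (A : ℕ → ℕ → ℕ) (a k q : ℕ) : ℕ :=
  A k q - if q = slideRow A a k then 1 else 0

section SlidePattern

variable {A : ℕ → ℕ → ℕ} {a : ℕ}

theorem slideRow_succ_cases (A : ℕ → ℕ → ℕ) (a k : ℕ) :
    (A (k + 1) (slideRow A a k + 1) = A k (slideRow A a k) ∧
      slideRow A a (k + 1) = slideRow A a k + 1) ∨
    (A (k + 1) (slideRow A a k + 1) ≠ A k (slideRow A a k) ∧
      slideRow A a (k + 1) = slideRow A a k) := by
  rw [slideRow]
  split_ifs with h
  · exact Or.inl ⟨h, rfl⟩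
  · exact Or.inr ⟨h, rfl⟩

theorem slidePattern_self (A : ℕ → ℕ → ℕ) (a k : ℕ) :
    slidePattern A a k (slideRow A a k) = A k (slideRow A a k) - 1 := by
  rw [slidePattern, if_pos rfl]

theorem slidePattern_of_ne (A : ℕ → ℕ → ℕ) {a k q : ℕ} (hq : q ≠ slideRow A a k) :
    slidePattern A a k q = A k q := by
  rw [slidePattern, if_neg hq, Nat.sub_zero]

theorem slideRow_corner (hA : IsGTPattern A) (ha : A 0 (a + 1) < A 0 a) (k : ℕ) :
    A k (slideRow A a k + 1) < A k (slideRow A a k) := by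
  induction k with
  | zero => exact ha
  | succ k ih =>
    have h₁ := hA.strip k (slideRow A a k)
    have h₂ := hA.strip k (slideRow A a k + 1)
    have h₃ := hA.mono k (slideRow A a k)
    rcases slideRow_succ_cases A a k with ⟨h, h'⟩ | ⟨h, h'⟩ <;> rw [h'] <;> omega

theorem slideRow_stable (hA : IsGTPattern A) (ha : A 0 (a + 1) < A 0 a)
    {K : ℕ} (hK : ∀ k, K ≤ k → A k = A K) (k : ℕ) (hk : K ≤ k) :
    slideRow A a k = slideRow A a K := by
  induction k, hk using Nat.le_induction with
  | base => rfl
  | succ k hk ih =>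
    have hcorner := slideRow_corner hA ha k
    rcases slideRow_succ_cases A a k with ⟨h, -⟩ | ⟨-, h⟩
    · rw [hK (k + 1) (by omega), ← hK k hk] at h
      omega
    · rw [h, ih]

theorem IsGTPattern.slide (hA : IsGTPattern A) (ha : A 0 (a + 1) < A 0 a) :
    IsGTPattern (slidePattern A a) where
  mono k q := by
    have hcorner := slideRow_corner hA ha k
    have hmono := hA.mono k q
    unfold slidePattern
    rcases slideRow_succ_cases A a k with ⟨h, h'⟩ | ⟨-, h'⟩ <;> rw [h']
    · rcases eq_or_ne q (slideRow A a k + 1) with rfl | hq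
      · rw [if_pos rfl, if_neg (by omega)]
        omega
      · rw [if_neg hq]
        omega
    · omega
  strip k q := by
    have hstrip := hA.strip k q
    unfold slidePattern
    rcases slideRow_succ_cases A a k with ⟨h, h'⟩ | ⟨h, h'⟩ <;> rw [h'] <;>
      rcases eq_or_ne q (slideRow A a k) with rfl | hq
    · rw [if_pos rfl, if_pos rfl]
      omega
    · rw [if_neg hq]
      omega
    · rw [if_pos rfl, if_neg (by omega)]
      omega
    · rw [if_neg hq]
      omega
  stable := by
    obtain ⟨K, hK⟩ := hA.stable
    refine ⟨K, fun k hk => funext fun q => ?_⟩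
    simp only [slidePattern, slideRow_stable hA ha hK k hk, hK k hk]
  supp k := by
    obtain ⟨Q, hQ⟩ := hA.supp k
    refine ⟨Q, fun q hq => ?_⟩
    rw [slidePattern, hQ q hq, Nat.zero_sub]

end SlidePattern

/-! ### Fillings of patterns -/

open Classical in
/-- The filling encoded by a pattern: square `(q, j)` contains `k` if `A k q ≤ j < A (k + 1) q`. -/
noncomputable def fill (A : ℕ → ℕ → ℕ) : Filling := fun s =>
  if h : ∃ k, A k s.1 ≤ s.2 ∧ s.2 < A (k + 1) s.1 then ((Nat.find h : ℕ) : WithTop ℕ) else ⊤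

section Fill

variable {A : ℕ → ℕ → ℕ} {q j k : ℕ}

theorem fill_eq_natCast_iff (hA : IsGTPattern A) :
    fill A (q, j) = (k : WithTop ℕ) ↔ A k q ≤ j ∧ j < A (k + 1) q := by
  classical
  refine ⟨fun h => ?_, fun h => ?_⟩
  · unfold fill at h
    split_ifs at h with hex
    · exact Nat.cast_inj.1 h ▸ Nat.find_spec hex
    · exact absurd h.symm (WithTop.natCast_ne_top k)
  · have hex : ∃ k, A k (q, j).1 ≤ (q, j).2 ∧ (q, j).2 < A (k + 1) (q, j).1 := ⟨k, h⟩
    have hlt := (Nat.find_spec hex).2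
    rw [fill, dif_pos hex, Nat.cast_inj]
    refine le_antisymm (Nat.find_min' hex h) (le_of_not_gt fun hfind => ?_)
    exact (hlt.trans_le (hA.monotone q hfind)).not_ge h.1

theorem fill_ne_top_iff (hA : IsGTPattern A) :
    fill A (q, j) ≠ ⊤ ↔ ∃ k, A k q ≤ j ∧ j < A (k + 1) q := by
  simp only [WithTop.ne_top_iff_exists, eq_comm (b := fill A (q, j))]
  exact exists_congr fun k => fill_eq_natCast_iff hA

theorem natCast_le_fill_iff (hA : IsGTPattern A) (hj : A 0 q ≤ j) :
    (k : WithTop ℕ) ≤ fill A (q, j) ↔ A k q ≤ j := by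
  constructor
  · intro hk
    by_contra! hlt
    obtain ⟨m, hm, hm'⟩ : ∃ m < k, fill A (q, j) = (m : WithTop ℕ) := by
      clear hk
      induction k with
      | zero => omega
      | succ k ih =>
        rcases lt_or_ge j (A k q) with h | h
        · obtain ⟨m, hm, hfill⟩ := ih h
          exact ⟨m, by omega, hfill⟩
        · exact ⟨k, by omega, (fill_eq_natCast_iff hA).2 ⟨h, hlt⟩⟩
    rw [hm', Nat.cast_le] at hk
    omega
  · intro hk
    induction hfill : fill A (q, j) with
    | top => exact le_top
    | coe m =>
      have hm := ((fill_eq_natCast_iff hA).1 hfill).2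
      refine Nat.cast_le.2 (le_of_not_gt fun hmk => ?_)
      exact (hm.trans_le (hA.monotone q hmk)).not_ge hk

theorem fill_eq_top_of_lt (hA : IsGTPattern A) (hj : j < A 0 q) : fill A (q, j) = ⊤ := by
  by_contra h
  obtain ⟨k, hk, -⟩ := (fill_ne_top_iff hA).1 h
  exact (hj.trans_le (hA.monotone q k.zero_le)).not_ge hk

theorem fill_eq_top_of_le (hA : IsGTPattern A) {K : ℕ} (hK : ∀ k, K ≤ k → A k = A K)
    (hj : A K q ≤ j) : fill A (q, j) = ⊤ := by
  by_contra h
  obtain ⟨k, -, hk⟩ := (fill_ne_top_iff hA).1 h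
  have hmono : A (k + 1) q ≤ A (max K (k + 1)) q := hA.monotone q (le_max_right ..)
  rw [hK _ (le_max_left ..)] at hmono
  omega

theorem fill_ne_top_iff_of_stable (hA : IsGTPattern A) {K : ℕ} (hK : ∀ k, K ≤ k → A k = A K) :
    fill A (q, j) ≠ ⊤ ↔ A 0 q ≤ j ∧ j < A K q := by
  refine ⟨fun h => ⟨?_, ?_⟩, fun ⟨h₀, h⟩ htop => ?_⟩
  · exact le_of_not_gt fun hj => h (fill_eq_top_of_lt hA hj)
  · exact lt_of_not_ge fun hj => h (fill_eq_top_of_le hA hK hj)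
  · exact absurd ((natCast_le_fill_iff hA h₀).1 (htop ▸ le_top)) h.not_ge

theorem fill_le_of_le {j' : ℕ} (hA : IsGTPattern A) (hj : A 0 q ≤ j) (hjj : j ≤ j') :
    fill A (q, j) ≤ fill A (q, j') := by
  refine WithTop.forall_coe_le_iff_le.1 fun k hk => ?_
  exact (natCast_le_fill_iff hA (hj.trans hjj)).2 (((natCast_le_fill_iff hA hj).1 hk).trans hjj)

theorem fill_lt_of_lt {q' : ℕ} (hA : IsGTPattern A) (hj : A 0 q ≤ j) (hne : fill A (q, j) ≠ ⊤)
    (hq : q < q') : fill A (q, j) < fill A (q', j) := by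
  obtain ⟨k, hk⟩ := WithTop.ne_top_iff_exists.1 hne
  have hbounds := (fill_eq_natCast_iff hA).1 hk.symm
  have hbelow : A (k + 1) q' ≤ j := ((hA.antitone (k + 1) hq).trans (hA.strip k q)).trans hbounds.1
  rw [← hk]
  exact (Nat.cast_lt.2 k.lt_add_one).trans_le
    ((natCast_le_fill_iff hA ((hA.antitone 0 hq.le).trans hj)).2 hbelow)

theorem eq_of_fill_eq {B : ℕ → ℕ → ℕ} (hA : IsGTPattern A) (hB : IsGTPattern B)
    (hzero : A 0 = B 0) (hfill : fill A = fill B) : A = B := by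
  funext k q
  have hA' : A 0 q ≤ A k q := hA.monotone q k.zero_le
  have hB' : B 0 q ≤ B k q := hB.monotone q k.zero_le
  have key (j : ℕ) (hj : A 0 q ≤ j) : A k q ≤ j ↔ B k q ≤ j := by
    rw [← natCast_le_fill_iff hA hj, ← natCast_le_fill_iff hB (hzero ▸ hj), hfill]
  exact le_antisymm ((key _ (hzero ▸ hB')).2 le_rfl) ((key _ hA').1 le_rfl)

end Fill

/-! ### Slides of fillings of patterns -/

/-- The filling in the course of the slide into the corner in row `a`, after the entries smaller
than `k` have been passed. The empty square is the only one in which the two patterns of the second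
condition differ. -/
noncomputable def slideStage (A : ℕ → ℕ → ℕ) (a k : ℕ) : Filling := fun s =>
  if s.2 < slidePattern A a k s.1 then fill (slidePattern A a) s
  else if s.2 < A k s.1 then ⊤ else fill A s

/-- The filling obtained from `F` when the empty square moves from `(a, b)` to `(a, b + n)`,
passing `n` entries `k`. -/
def shiftRow (F : Filling) (a b n k : ℕ) : Filling := fun s =>
  if s.1 = a ∧ b ≤ s.2 ∧ s.2 < b + n then (k : WithTop ℕ)
  else if s = (a, b + n) then ⊤ else F s

section ShiftRow

variable {F : Filling} {a b : ℕ}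

theorem shiftRow_zero (k : ℕ) (hF : F (a, b) = ⊤) : shiftRow F a b 0 k = F := by
  funext s
  rw [shiftRow, if_neg (by omega)]
  split_ifs with hs
  · rw [hs, add_zero, hF]
  · rfl

theorem shiftRow_succ (F : Filling) (a b n k : ℕ) :
    shiftRow F a b (n + 1) k = Function.update (Function.update (shiftRow F a b n k) (a, b + n) k)
      (a, b + n + 1) ⊤ := by
  funext ⟨q, j⟩
  simp only [shiftRow, Function.update_apply, Prod.mk.injEq]
  split_ifs <;> first | rfl | omega

theorem Slide.of_shiftRow {n k : ℕ} {F' : Filling} {t : ℕ × ℕ} (hhole : F (a, b) = ⊤)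
    (hright : ∀ j, b < j → j ≤ b + n → F (a, j) = (k : WithTop ℕ))
    (hbelow : ∀ j, b ≤ j → (k : WithTop ℕ) < F (a + 1, j))
    (h : Slide (shiftRow F a b n k) (a, b + n) F' t) : Slide F (a, b) F' t := by
  induction n with
  | zero => rwa [shiftRow_zero k hhole] at h
  | succ n ih =>
    have hr : shiftRow F a b n k (a, b + n + 1) = k := by
      simpa [shiftRow] using hright (b + n + 1) (by omega) (by omega)
    have hb : shiftRow F a b n k (a + 1, b + n) = F (a + 1, b + n) := by simp [shiftRow]
    refine ih (fun j hj hj' => hright j hj (by omega)) (Slide.left _ _ _ _ _ ?_ ?_)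
    · rw [hr, hb]
      exact hbelow _ (by omega)
    · rwa [hr, ← shiftRow_succ]

end ShiftRow

section SlideStage

variable {A : ℕ → ℕ → ℕ} {a k q j b : ℕ}

theorem slidePattern_le (A : ℕ → ℕ → ℕ) (a k q : ℕ) : slidePattern A a k q ≤ A k q :=
  Nat.sub_le _ _

theorem slideStage_of_le (hj : A k q ≤ j) : slideStage A a k (q, j) = fill A (q, j) := by
  have := slidePattern_le A a k q
  simp only [slideStage]
  rw [if_neg (by omega), if_neg (by omega)]

theorem slideStage_hole (hb : A k (slideRow A a k) = b + 1) :
    slideStage A a k (slideRow A a k, b) = ⊤ := by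
  simp only [slideStage]
  rw [slidePattern_self, if_neg (by omega), if_pos (by omega)]

theorem slideStage_succ_eq_natCast (hA : IsGTPattern A) (ha : A 0 (a + 1) < A 0 a)
    (hj : slidePattern A a k q ≤ j) (hj' : j < slidePattern A a (k + 1) q) :
    slideStage A a (k + 1) (q, j) = (k : WithTop ℕ) := by
  rw [slideStage, if_pos hj', (fill_eq_natCast_iff (hA.slide ha)).2 ⟨hj, hj'⟩]

theorem le_of_slidePattern_le (hb : A k (slideRow A a k) = b + 1)
    (hne : (q, j) ≠ (slideRow A a k, b)) (hj : slidePattern A a k q ≤ j) : A k q ≤ j := by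
  rcases eq_or_ne q (slideRow A a k) with rfl | hq
  · rw [slidePattern_self] at hj
    have : j ≠ b := fun hjb => hne (by rw [hjb])
    omega
  · rwa [slidePattern_of_ne A hq] at hj

theorem slideStage_succ_of_ne {b' : ℕ} (hA : IsGTPattern A) (ha : A 0 (a + 1) < A 0 a)
    (hb : A k (slideRow A a k) = b + 1) (hb' : A (k + 1) (slideRow A a (k + 1)) = b' + 1)
    (hne : (q, j) ≠ (slideRow A a k, b)) (hne' : (q, j) ≠ (slideRow A a (k + 1), b')) :
    slideStage A a (k + 1) (q, j) = slideStage A a k (q, j) := by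
  have hmono := (hA.slide ha).mono k q
  have hle := slidePattern_le A a (k + 1) q
  rcases lt_or_ge j (slidePattern A a k q) with hj | hj
  · simp only [slideStage]
    rw [if_pos hj, if_pos (by omega)]
  have hj₁ := le_of_slidePattern_le hb hne hj
  rw [slideStage_of_le hj₁]
  rcases lt_or_ge j (slidePattern A a (k + 1) q) with hj' | hj'
  · rw [slideStage_succ_eq_natCast hA ha hj hj', (fill_eq_natCast_iff hA).2 ⟨hj₁, by omega⟩]
  · exact slideStage_of_le (le_of_slidePattern_le hb' hne' hj')

theorem Slide.of_slideStage_succ_down {F' : Filling} {t : ℕ × ℕ} (hA : IsGTPattern A)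
    (ha : A 0 (a + 1) < A 0 a) (hb : A k (slideRow A a k) = b + 1)
    (hdown : A (k + 1) (slideRow A a k + 1) = A k (slideRow A a k))
    (hrow : slideRow A a (k + 1) = slideRow A a k + 1)
    (h : Slide (slideStage A a (k + 1)) (slideRow A a k + 1, b) F' t) :
    Slide (slideStage A a k) (slideRow A a k, b) F' t := by
  have hb' : A (k + 1) (slideRow A a (k + 1)) = b + 1 := by rw [hrow, hdown, hb]
  have hcorner := slideRow_corner hA ha k
  have hmono := hA.mono k (slideRow A a k)
  have hbelow : slideStage A a k (slideRow A a k + 1, b) = (k : WithTop ℕ) := by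
    rw [slideStage_of_le (by omega), fill_eq_natCast_iff hA]
    omega
  have hnew : slideStage A a (k + 1) (slideRow A a k, b) = (k : WithTop ℕ) := by
    refine slideStage_succ_eq_natCast hA ha ?_ ?_
    · rw [slidePattern_self, hb, Nat.add_sub_cancel]
    · rw [slidePattern_of_ne A (by omega)]
      omega
  refine Slide.up _ _ _ _ _ (hbelow ▸ WithTop.natCast_ne_top k) ?_ ?_
  · rw [hbelow, slideStage_of_le (by omega), natCast_le_fill_iff hA]
    · omega
    · exact (hA.monotone _ k.zero_le).trans hb.le
  · convert h using 1
    funext ⟨q, j⟩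
    rcases eq_or_ne (q, j) (slideRow A a k + 1, b) with hs | hs
    · rw [hs, Function.update_self, ← hrow, slideStage_hole hb']
    rw [Function.update_of_ne hs]
    rcases eq_or_ne (q, j) (slideRow A a k, b) with hs' | hs'
    · rw [hs', Function.update_self, hbelow, hnew]
    rw [Function.update_of_ne hs', slideStage_succ_of_ne hA ha hb hb' hs' (hrow ▸ hs)]

theorem Slide.of_slideStage_succ_right {n : ℕ} {F' : Filling} {t : ℕ × ℕ} (hA : IsGTPattern A)
    (ha : A 0 (a + 1) < A 0 a) (hb : A k (slideRow A a k) = b + 1)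
    (hn : A (k + 1) (slideRow A a k) = b + n + 1)
    (hright : A (k + 1) (slideRow A a k + 1) ≠ A k (slideRow A a k))
    (hrow : slideRow A a (k + 1) = slideRow A a k)
    (h : Slide (slideStage A a (k + 1)) (slideRow A a k, b + n) F' t) :
    Slide (slideStage A a k) (slideRow A a k, b) F' t := by
  have hb' : A (k + 1) (slideRow A a (k + 1)) = b + n + 1 := by rw [hrow, hn]
  have hcorner := slideRow_corner hA ha k
  have hstrip := hA.strip k (slideRow A a k)
  have hzero : A 0 (slideRow A a k + 1) ≤ A k (slideRow A a k + 1) := hA.monotone _ k.zero_le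
  refine Slide.of_shiftRow (n := n) (k := k) (slideStage_hole hb) (fun j hj hj' => ?_)
    (fun j hj => ?_) ?_
  · rw [slideStage_of_le (by omega), fill_eq_natCast_iff hA]
    omega
  · rw [slideStage_of_le (by omega)]
    exact (Nat.cast_lt.2 k.lt_add_one).trans_le
      ((natCast_le_fill_iff hA (by omega)).2 (by omega))
  · convert h using 1
    funext ⟨q, j⟩
    simp only [shiftRow]
    split_ifs with hs hs'
    · obtain ⟨rfl, hj, hj'⟩ := hs
      refine (slideStage_succ_eq_natCast hA ha ?_ ?_).symm
      · rwa [slidePattern_self, hb]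
      · rw [← hrow, slidePattern_self, hb']
        omega
    · rw [hs', ← hrow, slideStage_hole hb']
    · refine (slideStage_succ_of_ne hA ha hb hb' (fun heq => ?_) (hrow ▸ hs')).symm
      simp only [Prod.mk.injEq] at heq hs'
      omega

theorem slide_slideStage {F' : Filling} {t : ℕ × ℕ} (hA : IsGTPattern A)
    (ha : A 0 (a + 1) < A 0 a) (k : ℕ)
    (h : Slide (slideStage A a k) (slideRow A a k, A k (slideRow A a k) - 1) F' t) :
    Slide (slideStage A a 0) (a, A 0 a - 1) F' t := by
  induction k with
  | zero => exact h
  | succ k ih =>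
    obtain ⟨b, hb⟩ := Nat.exists_eq_add_of_lt (Nat.zero_lt_of_lt (slideRow_corner hA ha k))
    rw [zero_add] at hb
    refine ih ?_
    rw [hb, Nat.add_sub_cancel]
    rcases slideRow_succ_cases A a k with ⟨hdown, hrow⟩ | ⟨hright, hrow⟩ <;> rw [hrow] at h
    · rw [hdown, hb, Nat.add_sub_cancel] at h
      exact Slide.of_slideStage_succ_down hA ha hb hdown hrow h
    · obtain ⟨n, hn⟩ := Nat.exists_eq_add_of_le (hA.mono k (slideRow A a k))
      rw [hb, add_right_comm] at hn
      rw [hn, Nat.add_sub_cancel] at h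
      exact Slide.of_slideStage_succ_right hA ha hb hn hright hrow h

theorem slideStage_zero (hA : IsGTPattern A) (ha : A 0 (a + 1) < A 0 a) :
    slideStage A a 0 = fill A := by
  funext ⟨q, j⟩
  have hle := slidePattern_le A a 0 q
  simp only [slideStage]
  split_ifs with hj hj'
  · rw [fill_eq_top_of_lt (hA.slide ha) hj, fill_eq_top_of_lt hA (by omega)]
  · rw [fill_eq_top_of_lt hA hj']
  · rfl

theorem slidePattern_stable {K : ℕ} (hA : IsGTPattern A) (ha : A 0 (a + 1) < A 0 a)
    (hK : ∀ k, K ≤ k → A k = A K) (k : ℕ) (hk : K ≤ k) :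
    slidePattern A a k = slidePattern A a K := by
  funext q
  simp only [slidePattern, slideRow_stable hA ha hK k hk, hK k hk]

theorem slideStage_of_stable {K : ℕ} (hA : IsGTPattern A) (ha : A 0 (a + 1) < A 0 a)
    (hK : ∀ k, K ≤ k → A k = A K) : slideStage A a K = fill (slidePattern A a) := by
  funext ⟨q, j⟩
  have htop (hj : slidePattern A a K q ≤ j) : fill (slidePattern A a) (q, j) = ⊤ :=
    fill_eq_top_of_le (hA.slide ha) (slidePattern_stable hA ha hK) hj
  simp only [slideStage]
  split_ifs with hj hj'
  · rfl
  · rw [htop (by omega)]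
  · rw [htop ((slidePattern_le A a K q).trans (by omega)),
      fill_eq_top_of_le hA hK (by omega)]

theorem slide_fill {K : ℕ} (hA : IsGTPattern A) (ha : A 0 (a + 1) < A 0 a)
    (hK : ∀ k, K ≤ k → A k = A K) :
    Slide (fill A) (a, A 0 a - 1) (fill (slidePattern A a))
      (slideRow A a K, A K (slideRow A a K) - 1) := by
  rw [← slideStage_zero hA ha, ← slideStage_of_stable hA ha hK]
  have hcorner := slideRow_corner hA ha K
  refine slide_slideStage hA ha K (Slide.done _ _ _ ?_ ?_) <;>
    rw [slideStage_of_le (by omega), fill_eq_top_of_le hA hK (by omega)]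

end SlideStage

theorem Slide.unique {T T₁ T₂ : Filling} {s t₁ t₂ : ℕ × ℕ} (h₁ : Slide T s T₁ t₁)
    (h₂ : Slide T s T₂ t₂) : T₁ = T₂ ∧ t₁ = t₂ := by
  induction h₁ with
  | done T i j hr hb =>
    cases h₂ with
    | done => exact ⟨rfl, rfl⟩
    | up _ _ _ _ _ hne => exact absurd hb hne
    | left _ _ _ _ _ hlt => exact absurd (hr ▸ hlt) not_top_lt
  | up T T' i j t hne hle next ih =>
    cases h₂ with
    | done _ _ _ hr hb => exact absurd hb hne
    | up _ _ _ _ _ _ _ next' => exact ih next'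
    | left _ _ _ _ _ hlt => exact absurd hlt hle.not_gt
  | left T T' i j t hlt next ih =>
    cases h₂ with
    | done _ _ _ hr hb => exact absurd (hr ▸ hlt) not_top_lt
    | up _ _ _ _ _ _ hle => exact absurd hlt hle.not_gt
    | left _ _ _ _ _ _ next' => exact ih next'

/-! ### First and last maxima -/

section Maxima

variable {ι α : Type*}

/-- `p` is the last place where `f` is maximal. -/
def IsLastMax [Preorder ι] [Preorder α] (f : ι → α) (p : ι) : Prop :=
  (∀ q, q < p → f q ≤ f p) ∧ ∀ q, p < q → f q < f p

/-- `p` is the first place where `f` is maximal. -/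
def IsFirstMax [Preorder ι] [Preorder α] (f : ι → α) (p : ι) : Prop :=
  (∀ q, q < p → f q < f p) ∧ ∀ q, p < q → f q ≤ f p

theorem IsLastMax.le [LinearOrder ι] [Preorder α] {f : ι → α} {p : ι} (h : IsLastMax f p)
    (q : ι) : f q ≤ f p := by
  rcases lt_trichotomy q p with hq | rfl | hq
  · exact h.1 q hq
  · exact le_rfl
  · exact (h.2 q hq).le

theorem IsFirstMax.le [LinearOrder ι] [Preorder α] {f : ι → α} {p : ι} (h : IsFirstMax f p)
    (q : ι) : f q ≤ f p := by
  rcases lt_trichotomy q p with hq | rfl | hq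
  · exact (h.1 q hq).le
  · exact le_rfl
  · exact h.2 q hq

theorem IsLastMax.unique [LinearOrder ι] [Preorder α] {f : ι → α} {p p' : ι}
    (h : IsLastMax f p) (h' : IsLastMax f p') : p = p' := by
  rcases lt_trichotomy p p' with hlt | rfl | hlt
  · exact absurd (h.2 p' hlt) (h'.le p).not_gt
  · rfl
  · exact absurd (h'.2 p hlt) (h.le p').not_gt

theorem IsFirstMax.unique [LinearOrder ι] [Preorder α] {f : ι → α} {p p' : ι}
    (h : IsFirstMax f p) (h' : IsFirstMax f p') : p = p' := by
  rcases lt_trichotomy p p' with hlt | rfl | hlt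
  · exact absurd (h'.1 p hlt) (h.le p').not_gt
  · rfl
  · exact absurd (h.1 p' hlt) (h'.le p).not_gt

theorem exists_forall_le_of_eventually_le [LinearOrder α] {f : ℕ → α} {q : ℕ}
    (h : ∀ᶠ n in Filter.atTop, f n ≤ f q) : ∃ m, ∀ n, f n ≤ f m := by
  obtain ⟨M, hM⟩ := Filter.eventually_atTop.1 h
  obtain ⟨m, -, hm⟩ := Finset.exists_max_image (Finset.range (max M q + 1)) f
    ⟨0, Finset.mem_range.2 (Nat.succ_pos _)⟩
  simp only [Finset.mem_range, Order.lt_add_one_iff] at hm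
  refine ⟨m, fun n => ?_⟩
  rcases le_total n (max M q) with hn | hn
  · exact hm n hn
  · exact (hM n ((le_max_left ..).trans hn)).trans (hm q (le_max_right ..))

theorem exists_isLastMax [LinearOrder α] {f : ℕ → α} {q : ℕ}
    (h : ∀ᶠ n in Filter.atTop, f n < f q) : ∃ p, IsLastMax f p := by
  classical
  obtain ⟨m, hm⟩ := exists_forall_le_of_eventually_le (h.mono fun n hn => hn.le)
  obtain ⟨M, hM⟩ := Filter.eventually_atTop.1 h
  have hmM : m < M := lt_of_not_ge fun hMm => (hM m hMm).not_ge (hm q)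
  have hp : f (Nat.findGreatest (fun n => f n = f m) M) = f m :=
    Nat.findGreatest_spec (P := fun n => f n = f m) hmM.le rfl
  refine ⟨_, fun n _ => (hm n).trans hp.ge, fun n hn => ?_⟩
  rcases le_or_gt n M with hnM | hnM
  · exact ((hm n).lt_of_ne (Nat.findGreatest_is_greatest hn hnM)).trans_eq hp.symm
  · exact (hM n hnM.le).trans_le ((hm q).trans hp.ge)

theorem exists_isFirstMax [LinearOrder α] {f : ℕ → α} {q : ℕ}
    (h : ∀ᶠ n in Filter.atTop, f n ≤ f q) : ∃ p, IsFirstMax f p := by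
  classical
  obtain ⟨m, hm⟩ := exists_forall_le_of_eventually_le h
  have hex : ∃ n, f n = f m := ⟨m, rfl⟩
  have hp := Nat.find_spec hex
  exact ⟨Nat.find hex, fun n hn => ((hm n).lt_of_ne (Nat.find_min hex hn)).trans_eq hp.symm,
    fun n _ => (hm n).trans hp.ge⟩

variable {f : ℕ → ℤ} {p m : ℕ}

theorem IsLastMax.update_add_one (h : IsLastMax f p) (hm : f m < f (m + 1)) :
    IsLastMax (Function.update f m (f m + 1)) p := by
  have hle := h.le (m + 1)
  have hpm : p ≠ m := fun hpm => hm.not_ge (hpm ▸ hle)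
  refine ⟨fun q hq => ?_, fun q hq => ?_⟩ <;> rw [Function.update_of_ne hpm] <;>
    rcases eq_or_ne q m with rfl | hqm
  · rw [Function.update_self]
    omega
  · rw [Function.update_of_ne hqm]
    exact h.1 q hq
  · have := h.2 (q + 1) (by omega)
    rw [Function.update_self]
    omega
  · rw [Function.update_of_ne hqm]
    exact h.2 q hq

theorem IsLastMax.update_sub_one (h : IsLastMax f p) (hpm : p ≠ m) :
    IsLastMax (Function.update f m (f m - 1)) p := by
  have hupdate (q : ℕ) : Function.update f m (f m - 1) q ≤ f q := by
    rcases eq_or_ne q m with rfl | hqm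
    · simp
    · rw [Function.update_of_ne hqm]
  refine ⟨fun q hq => ?_, fun q hq => ?_⟩ <;> rw [Function.update_of_ne hpm]
  · exact (hupdate q).trans (h.1 q hq)
  · exact (hupdate q).trans_lt (h.2 q hq)

theorem IsLastMax.update_sub_one_self (h : IsLastMax f (m + 1)) (hm : f (m + 1) ≤ f m) :
    IsLastMax (Function.update f (m + 1) (f (m + 1) - 1)) m := by
  refine ⟨fun q hq => ?_, fun q hq => ?_⟩ <;> rw [Function.update_of_ne (a := m) (by omega)]
  · rw [Function.update_of_ne (by omega)]
    exact (h.1 q (by omega)).trans hm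
  · rcases eq_or_ne q (m + 1) with rfl | hqm
    · rw [Function.update_self]
      omega
    · rw [Function.update_of_ne hqm]
      exact (h.2 q (by omega)).trans_le hm

end Maxima

/-! ### Row heights -/

/-- The number of letters `i + 1` in the rows up to `q` minus the number of letters `i` in the rows
before `q`. -/
def rowHeight (A : ℕ → ℕ → ℕ) (i q : ℕ) : ℤ :=
  ∑ j ∈ Finset.range (q + 1), ((A (i + 2) j : ℤ) - A (i + 1) j) -
    ∑ j ∈ Finset.range q, ((A (i + 1) j : ℤ) - A i j)

section RowHeight

variable {A : ℕ → ℕ → ℕ} {a i p q : ℕ}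

theorem rowHeight_zero (A : ℕ → ℕ → ℕ) (i : ℕ) :
    rowHeight A i 0 = (A (i + 2) 0 : ℤ) - A (i + 1) 0 := by
  simp [rowHeight]

theorem rowHeight_succ (A : ℕ → ℕ → ℕ) (i q : ℕ) :
    rowHeight A i (q + 1) =
      rowHeight A i q + A (i + 2) (q + 1) - A (i + 1) (q + 1) - A (i + 1) q + A i q := by
  simp only [rowHeight]
  rw [Finset.sum_range_succ _ (q + 1), Finset.sum_range_succ (fun j => (A (i + 1) j : ℤ) - A i j)]
  ring

theorem rowHeight_zero_nonneg (hA : IsGTPattern A) (i : ℕ) : 0 ≤ rowHeight A i 0 := by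
  have hmono : A (i + 1) 0 ≤ A (i + 2) 0 := hA.mono (i + 1) 0
  rw [rowHeight_zero]
  omega

theorem exists_eventually_rowHeight_eq (hA : IsGTPattern A) (i : ℕ) :
    ∃ q, ∀ᶠ n in Filter.atTop, rowHeight A i n = rowHeight A i q := by
  obtain ⟨Q, hQ⟩ := hA.supp (i + 2)
  have hvanish (k : ℕ) (hk : k ≤ i + 2) (q : ℕ) (hq : Q ≤ q) : A k q = 0 :=
    Nat.le_zero.1 ((hA.monotone q hk).trans_eq (hQ q hq))
  refine ⟨Q, Filter.eventually_atTop.2 ⟨Q, fun n hn => ?_⟩⟩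
  induction n, hn using Nat.le_induction with
  | base => rfl
  | succ n hn ih =>
    rw [rowHeight_succ, ih, hvanish i (by omega) n hn, hvanish (i + 1) (by omega) n hn,
      hvanish (i + 1) (by omega) (n + 1) (by omega), hQ (n + 1) (by omega)]
    simp

theorem IsLastMax.letters_of_rowHeight (hA : IsGTPattern A)
    (hp : IsLastMax (rowHeight A i) p) :
    A i p < A (i + 1) p ∧ A (i + 2) (p + 1) < A (i + 1) p := by
  have hlt := hp.2 (p + 1) (by omega)
  have hstrip := hA.strip i p
  have hmono : A (i + 1) (p + 1) ≤ A (i + 2) (p + 1) := hA.mono (i + 1) (p + 1)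
  rw [rowHeight_succ] at hlt
  omega

theorem IsFirstMax.letters_of_rowHeight (hA : IsGTPattern A)
    (hp : IsFirstMax (rowHeight A i) p) (hpos : 0 < rowHeight A i p) :
    A (i + 1) p < A (i + 2) p ∧ ∀ q, q + 1 = p → A (i + 1) p < A i q := by
  rcases p with _ | p
  · rw [rowHeight_zero] at hpos
    exact ⟨by omega, fun q hq => absurd hq (by omega)⟩
  · have hlt := hp.1 p (by omega)
    have hmono := hA.mono i p
    have hstrip : A (i + 2) (p + 1) ≤ A (i + 1) p := hA.strip (i + 1) p
    rw [rowHeight_succ] at hlt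
    refine ⟨by omega, fun q hq => ?_⟩
    obtain rfl : q = p := by omega
    omega

theorem rowHeight_slidePattern (hA : IsGTPattern A) (ha : A 0 (a + 1) < A 0 a) (i q : ℕ) :
    rowHeight (slidePattern A a) i q = rowHeight A i q
      - (if slideRow A a (i + 2) ≤ q then 1 else 0) + (if slideRow A a (i + 1) ≤ q then 1 else 0)
      + (if slideRow A a (i + 1) < q then 1 else 0) - (if slideRow A a i < q then 1 else 0) := by
  have hslide (k q : ℕ) :
      ((slidePattern A a k q : ℕ) : ℤ) = A k q - if q = slideRow A a k then 1 else 0 := by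
    have hcorner := slideRow_corner hA ha k
    rcases eq_or_ne q (slideRow A a k) with rfl | hq
    · rw [slidePattern_self, if_pos rfl]
      omega
    · rw [slidePattern_of_ne A hq, if_neg hq, sub_zero]
  induction q with
  | zero =>
    rw [rowHeight_zero, rowHeight_zero, hslide, hslide]
    split_ifs <;> omega
  | succ q ih =>
    rw [rowHeight_succ, rowHeight_succ, ih, hslide, hslide, hslide, hslide]
    omega

theorem rowHeight_slidePattern_cases (hA : IsGTPattern A) (ha : A 0 (a + 1) < A 0 a) (i : ℕ) :
    (slideRow A a i + slideRow A a (i + 2) = 2 * slideRow A a (i + 1) ∧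
      rowHeight (slidePattern A a) i = rowHeight A i) ∨
    (∃ r, slideRow A a i = r ∧ slideRow A a (i + 1) = r ∧ slideRow A a (i + 2) = r + 1 ∧
      rowHeight A i r < rowHeight A i (r + 1) ∧
      rowHeight (slidePattern A a) i = Function.update (rowHeight A i) r (rowHeight A i r + 1)) ∨
    (∃ r, slideRow A a i = r ∧ slideRow A a (i + 1) = r + 1 ∧ slideRow A a (i + 2) = r + 1 ∧
      rowHeight A i (r + 1) ≤ rowHeight A i r ∧
      rowHeight (slidePattern A a) i =
        Function.update (rowHeight A i) (r + 1) (rowHeight A i (r + 1) - 1)) := by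
  have hheight := rowHeight_slidePattern hA ha i
  have hsucc := rowHeight_succ A i (slideRow A a i)
  have hlower := hA.strip i (slideRow A a i)
  have hupper : A (i + 2) (slideRow A a i + 1) ≤ A (i + 1) (slideRow A a i) :=
    hA.strip (i + 1) (slideRow A a i)
  have hcases : (A (i + 2) (slideRow A a (i + 1) + 1) = A (i + 1) (slideRow A a (i + 1)) ∧
      slideRow A a (i + 2) = slideRow A a (i + 1) + 1) ∨ slideRow A a (i + 2) =
      slideRow A a (i + 1) := (slideRow_succ_cases A a (i + 1)).imp_right And.right
  rcases slideRow_succ_cases A a i with ⟨hdown, hs⟩ | ⟨hright, hs⟩ <;>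
    rw [hs] at hcases <;> rcases hcases with ⟨hdown', ht⟩ | ht <;>
    simp only [hs, ht] at hheight ⊢
  · refine Or.inl ⟨by omega, funext fun q => ?_⟩
    rw [hheight]
    omega
  · refine Or.inr (Or.inr ⟨_, rfl, rfl, rfl, by omega, funext fun q => ?_⟩)
    rw [hheight, Function.update_apply]
    split_ifs <;> subst_vars <;> omega
  · refine Or.inr (Or.inl ⟨_, rfl, rfl, rfl, by omega, funext fun q => ?_⟩)
    rw [hheight, Function.update_apply]
    split_ifs <;> subst_vars <;> omega
  · refine Or.inl ⟨by omega, funext fun q => ?_⟩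
    rw [hheight]
    omega

theorem exists_rowHeight_slidePattern_le (hA : IsGTPattern A) (ha : A 0 (a + 1) < A 0 a)
    (i q : ℕ) : ∃ q', rowHeight (slidePattern A a) i q ≤ rowHeight A i q' := by
  rcases rowHeight_slidePattern_cases hA ha i with
    ⟨-, h⟩ | ⟨r, -, -, -, hr, h⟩ | ⟨r, -, -, -, hr, h⟩ <;> rw [h]
  · exact ⟨q, le_rfl⟩
  · rcases eq_or_ne q r with rfl | hq
    · exact ⟨q + 1, by rw [Function.update_self]; omega⟩
    · exact ⟨q, by rw [Function.update_of_ne hq]⟩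
  · rcases eq_or_ne q (r + 1) with rfl | hq
    · exact ⟨r, by rw [Function.update_self]; omega⟩
    · exact ⟨q, by rw [Function.update_of_ne hq]⟩

theorem eventually_rowHeight_slidePattern_eq (hA : IsGTPattern A) (ha : A 0 (a + 1) < A 0 a)
    (i : ℕ) :
    ∀ᶠ n in Filter.atTop, rowHeight (slidePattern A a) i n = rowHeight A i n := by
  filter_upwards [Filter.eventually_gt_atTop (slideRow A a i),
    Filter.eventually_gt_atTop (slideRow A a (i + 1)),
    Filter.eventually_gt_atTop (slideRow A a (i + 2))] with n hr hs ht
  rw [rowHeight_slidePattern hA ha]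
  omega

theorem IsLastMax.rowHeight_slidePattern_of_ne (hA : IsGTPattern A) (ha : A 0 (a + 1) < A 0 a)
    (hp : IsLastMax (rowHeight A i) p)
    (hne : slideRow A a (i + 1) = slideRow A a i + 1 → slideRow A a (i + 1) ≠ p) :
    IsLastMax (rowHeight (slidePattern A a) i) p := by
  rcases rowHeight_slidePattern_cases hA ha i with
    ⟨-, h⟩ | ⟨r, -, -, -, hr, h⟩ | ⟨r, hr, hs, -, -, h⟩ <;> rw [h]
  · exact hp
  · exact hp.update_add_one hr
  · exact hp.update_sub_one (hs ▸ (hne (by omega)).symm)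

theorem IsLastMax.rowHeight_slidePattern_of_eq (hA : IsGTPattern A) (ha : A 0 (a + 1) < A 0 a)
    (hp : IsLastMax (rowHeight A i) p) (hdown : slideRow A a (i + 1) = slideRow A a i + 1)
    (hs : slideRow A a (i + 1) = p) :
    slideRow A a (i + 2) = p ∧ IsLastMax (rowHeight (slidePattern A a) i) (slideRow A a i) := by
  have hlt := (hp.letters_of_rowHeight hA).2
  have ht : slideRow A a (i + 2) = p := by
    rcases slideRow_succ_cases A a (i + 1) with ⟨h, -⟩ | ⟨-, h⟩
    · rw [hs] at h
      exact absurd h hlt.ne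
    · rw [h, hs]
  rcases rowHeight_slidePattern_cases hA ha i with
    ⟨h, -⟩ | ⟨r, h, h', -, -, -⟩ | ⟨r, hr, -, -, hle, h⟩
  · omega
  · omega
  · obtain rfl : r + 1 = p := by omega
    rw [h, hr]
    exact ⟨ht, hp.update_sub_one_self hle⟩

end RowHeight

/-! ### Coplactic operations on patterns -/

/-- The pattern in which the last letter `i` of row `p` is replaced by `i + 1`. -/
def lowerAt (A : ℕ → ℕ → ℕ) (i p : ℕ) : ℕ → ℕ → ℕ :=
  Function.update A (i + 1) fun q => A (i + 1) q - if q = p then 1 else 0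

/-- The pattern in which the first letter `i + 1` of row `p` is replaced by `i`. -/
def raiseAt (A : ℕ → ℕ → ℕ) (i p : ℕ) : ℕ → ℕ → ℕ :=
  Function.update A (i + 1) fun q => A (i + 1) q + if q = p then 1 else 0

/-- The coplactic operation on patterns: `B = f_i(A)` and `A = e_i(B)`. The operation acts in the
last row in which the row height of `A` is maximal. -/
def Lowers (i : ℕ) (A B : ℕ → ℕ → ℕ) : Prop :=
  IsGTPattern A ∧ ∃ p, IsLastMax (rowHeight A i) p ∧ B = lowerAt A i p

section Lowering

variable {A B C : ℕ → ℕ → ℕ} {a i k p : ℕ}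

theorem lowerAt_of_ne (A : ℕ → ℕ → ℕ) (p : ℕ) (hk : k ≠ i + 1) : lowerAt A i p k = A k :=
  Function.update_of_ne hk ..

theorem lowerAt_succ (A : ℕ → ℕ → ℕ) (i p q : ℕ) :
    lowerAt A i p (i + 1) q = A (i + 1) q - if q = p then 1 else 0 := by
  rw [lowerAt, Function.update_self]

theorem lowerAt_raiseAt (A : ℕ → ℕ → ℕ) (i p : ℕ) : lowerAt (raiseAt A i p) i p = A := by
  simp [lowerAt, raiseAt]

theorem IsGTPattern.lowerAt (hA : IsGTPattern A) (hletter : A i p < A (i + 1) p)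
    (hbelow : A (i + 2) (p + 1) < A (i + 1) p) : IsGTPattern (lowerAt A i p) := by
  refine hA.update_level (fun q => ?_) (fun q => ?_) (fun q => ?_) (fun q => ?_)
  · have := hA.mono i q
    split_ifs <;> subst_vars <;> omega
  · exact (Nat.sub_le ..).trans (hA.mono (i + 1) q)
  · exact (Nat.sub_le ..).trans (hA.strip i q)
  · have : A (i + 2) (q + 1) ≤ A (i + 1) q := hA.strip (i + 1) q
    split_ifs <;> subst_vars <;> omega

theorem IsGTPattern.raiseAt (hA : IsGTPattern A) (hletter : A (i + 1) p < A (i + 2) p)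
    (habove : ∀ q, q + 1 = p → A (i + 1) p < A i q) : IsGTPattern (raiseAt A i p) := by
  refine hA.update_level (fun q => ?_) (fun q => ?_) (fun q => ?_) (fun q => ?_)
  · exact (hA.mono i q).trans (Nat.le_add_right ..)
  · have : A (i + 1) q ≤ A (i + 2) q := hA.mono (i + 1) q
    split_ifs <;> subst_vars <;> omega
  · have := hA.strip i q
    split_ifs with h
    · have := habove q h
      rw [h]
      omega
    · omega
  · exact (hA.strip (i + 1) q).trans (Nat.le_add_right ..)

theorem Lowers.isGTPattern (h : Lowers i A B) : IsGTPattern B := by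
  obtain ⟨hA, p, hp, rfl⟩ := h
  obtain ⟨hletter, hbelow⟩ := hp.letters_of_rowHeight hA
  exact hA.lowerAt hletter hbelow

theorem Lowers.eq_of_ne (h : Lowers i A B) (hk : k ≠ i + 1) : B k = A k := by
  obtain ⟨-, p, -, rfl⟩ := h
  exact lowerAt_of_ne A p hk

theorem Lowers.unique (hB : Lowers i A B) (hC : Lowers i A C) : B = C := by
  obtain ⟨-, p, hp, rfl⟩ := hB
  obtain ⟨-, p', hp', rfl⟩ := hC
  rw [hp.unique hp']

theorem rowHeight_lowerAt (hp : 0 < A (i + 1) p) (q : ℕ) :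
    rowHeight (lowerAt A i p) i q =
      rowHeight A i q + (if p ≤ q then 1 else 0) + (if p < q then 1 else 0) := by
  have hlower (q : ℕ) :
      (lowerAt A i p (i + 1) q : ℤ) = A (i + 1) q - if q = p then 1 else 0 := by
    rw [lowerAt_succ]
    split_ifs with hq
    · rw [hq]
      omega
    · simp
  have hi : lowerAt A i p i = A i := lowerAt_of_ne A p (by omega)
  have hi' : lowerAt A i p (i + 2) = A (i + 2) := lowerAt_of_ne A p (by omega)
  induction q with
  | zero =>
    rw [rowHeight_zero, rowHeight_zero, hlower, hi']
    split_ifs <;> omega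
  | succ q ih =>
    rw [rowHeight_succ, rowHeight_succ, ih, hlower, hlower, hi, hi']
    split_ifs <;> omega

theorem isFirstMax_rowHeight_lowerAt_iff (hp : 0 < A (i + 1) p) :
    IsFirstMax (rowHeight (lowerAt A i p) i) p ↔ IsLastMax (rowHeight A i) p := by
  refine and_congr (forall₂_congr fun q hq => ?_) (forall₂_congr fun q hq => ?_) <;>
    rw [rowHeight_lowerAt hp, rowHeight_lowerAt hp]
  · rw [if_neg (by omega), if_neg (by omega), if_pos le_rfl, if_neg (lt_irrefl p)]
    omega
  · rw [if_pos hq.le, if_pos hq, if_pos le_rfl, if_neg (lt_irrefl p)]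
    omega

theorem Lowers.unique_left (hA : Lowers i A C) (hB : Lowers i B C) : A = B := by
  have hne (k : ℕ) (hk : k ≠ i + 1) : A k = B k := by rw [← hA.eq_of_ne hk, hB.eq_of_ne hk]
  obtain ⟨hA, p, hp, rfl⟩ := hA
  obtain ⟨hB, p', hp', hAB⟩ := hB
  have hApos := Nat.zero_lt_of_lt (hp.letters_of_rowHeight hA).1
  have hBpos := Nat.zero_lt_of_lt (hp'.letters_of_rowHeight hB).1
  obtain rfl : p = p' := ((isFirstMax_rowHeight_lowerAt_iff hApos).2 hp).unique
    (hAB ▸ (isFirstMax_rowHeight_lowerAt_iff hBpos).2 hp')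
  funext k q
  rcases eq_or_ne k (i + 1) with rfl | hk
  · have hq := congrFun (congrFun hAB (i + 1)) q
    rw [lowerAt_succ, lowerAt_succ] at hq
    rcases eq_or_ne q p with rfl | hqp
    · rw [if_pos rfl] at hq
      omega
    · rwa [if_neg hqp, Nat.sub_zero, Nat.sub_zero] at hq
  · rw [hne k hk]

theorem exists_lowers_iff (hA : IsGTPattern A) (i : ℕ) :
    (∃ B, Lowers i A B) ↔
      ∃ q, ∀ᶠ n in Filter.atTop, rowHeight A i n < rowHeight A i q := by
  constructor
  · rintro ⟨B, -, p, hp, -⟩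
    exact ⟨p, (Filter.eventually_gt_atTop p).mono hp.2⟩
  · rintro ⟨q, hq⟩
    obtain ⟨p, hp⟩ := exists_isLastMax hq
    exact ⟨_, hA, p, hp, rfl⟩

theorem Lowers.raiseAt (hA : IsGTPattern A) (hp : IsFirstMax (rowHeight A i) p)
    (hpos : 0 < rowHeight A i p) : Lowers i (raiseAt A i p) A := by
  obtain ⟨hletter, habove⟩ := hp.letters_of_rowHeight hA hpos
  refine ⟨hA.raiseAt hletter habove, p, ?_, (lowerAt_raiseAt A i p).symm⟩
  rwa [← isFirstMax_rowHeight_lowerAt_iff, lowerAt_raiseAt]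
  simp [_root_.raiseAt]

theorem exists_raises_iff (hB : IsGTPattern B) (i : ℕ) :
    (∃ A, Lowers i A B) ↔ ∃ q, 0 < rowHeight B i q := by
  constructor
  · rintro ⟨A, hA, p, hp, rfl⟩
    refine ⟨p, ?_⟩
    rw [rowHeight_lowerAt (Nat.zero_lt_of_lt (hp.letters_of_rowHeight hA).1), if_pos le_rfl,
      if_neg (lt_irrefl p)]
    have := (rowHeight_zero_nonneg hA i).trans (hp.le 0)
    omega
  · rintro ⟨q, hq⟩
    obtain ⟨m, hm⟩ := exists_eventually_rowHeight_eq hB i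
    obtain ⟨p, hp⟩ := exists_isFirstMax (hm.mono fun n hn => hn.le)
    exact ⟨_, Lowers.raiseAt hB hp (hq.trans_le (hp.le q))⟩

end Lowering

/-! ### Coplactic operations commute with slides of patterns -/

section LowersSlide

variable {A B : ℕ → ℕ → ℕ} {a i p : ℕ}

theorem exists_lowers_of_slidePattern (hA : IsGTPattern A) (ha : A 0 (a + 1) < A 0 a) (i : ℕ)
    (h : ∃ B, Lowers i (slidePattern A a) B) : ∃ B, Lowers i A B := by
  rw [exists_lowers_iff (hA.slide ha)] at h
  rw [exists_lowers_iff hA]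
  obtain ⟨q, hq⟩ := h
  obtain ⟨q', hq'⟩ := exists_rowHeight_slidePattern_le hA ha i q
  refine ⟨q', ?_⟩
  filter_upwards [hq, eventually_rowHeight_slidePattern_eq hA ha i] with n hn hn'
  exact (hn'.symm.trans_lt hn).trans_le hq'

theorem exists_raises_of_slidePattern (hA : IsGTPattern A) (ha : A 0 (a + 1) < A 0 a) (i : ℕ)
    (h : ∃ B, Lowers i B (slidePattern A a)) : ∃ B, Lowers i B A := by
  rw [exists_raises_iff (hA.slide ha)] at h
  rw [exists_raises_iff hA]
  obtain ⟨q, hq⟩ := h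
  obtain ⟨q', hq'⟩ := exists_rowHeight_slidePattern_le hA ha i q
  exact ⟨q', hq.trans_le hq'⟩

theorem slideRow_congr {m : ℕ} (h : ∀ k, k ≤ m → B k = A k) : slideRow B a m = slideRow A a m := by
  induction m with
  | zero => rfl
  | succ m ih =>
    rw [slideRow, slideRow, ih fun k hk => h k (by omega), h m (by omega), h (m + 1) le_rfl]

theorem slideRow_congr_of_le {m k : ℕ} (hm : slideRow B a m = slideRow A a m)
    (h : ∀ k, m ≤ k → B k = A k) (hk : m ≤ k) : slideRow B a k = slideRow A a k := by
  induction k, hk using Nat.le_induction with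
  | base => exact hm
  | succ k hk ih => rw [slideRow, slideRow, ih, h k hk, h (k + 1) (by omega)]

theorem slideRow_lowerAt_of_le {k : ℕ} (hk : k ≤ i) :
    slideRow (lowerAt A i p) a k = slideRow A a k :=
  slideRow_congr fun _ hm => lowerAt_of_ne A p (by omega)

theorem slideRow_lowerAt_succ (A : ℕ → ℕ → ℕ) (a i p : ℕ) :
    slideRow (lowerAt A i p) a (i + 1) =
      if A (i + 1) (slideRow A a i + 1) - (if slideRow A a i + 1 = p then 1 else 0) =
        A i (slideRow A a i) then slideRow A a i + 1 else slideRow A a i := by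
  rw [slideRow, slideRow_lowerAt_of_le le_rfl, lowerAt_of_ne A p (show i ≠ i + 1 by omega),
    lowerAt_succ]

theorem slideRow_lowerAt_add_two (A : ℕ → ℕ → ℕ) (a i p : ℕ) :
    slideRow (lowerAt A i p) a (i + 2) =
      if A (i + 2) (slideRow (lowerAt A i p) a (i + 1) + 1) =
          A (i + 1) (slideRow (lowerAt A i p) a (i + 1)) -
            (if slideRow (lowerAt A i p) a (i + 1) = p then 1 else 0)
        then slideRow (lowerAt A i p) a (i + 1) + 1 else slideRow (lowerAt A i p) a (i + 1) := by
  rw [slideRow, lowerAt_of_ne A p (show i + 1 + 1 ≠ i + 1 by omega), lowerAt_succ]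

theorem slideRow_lowerAt_of_ne (hA : IsGTPattern A) (hp : IsLastMax (rowHeight A i) p)
    (hne : slideRow A a (i + 1) = slideRow A a i + 1 → slideRow A a (i + 1) ≠ p) :
    slideRow (lowerAt A i p) a (i + 1) = slideRow A a (i + 1) ∧
      slideRow (lowerAt A i p) a (i + 2) = slideRow A a (i + 2) := by
  have hstrip := hA.strip i (slideRow A a i)
  have hs : slideRow (lowerAt A i p) a (i + 1) = slideRow A a (i + 1) := by
    rw [slideRow_lowerAt_succ]
    rcases slideRow_succ_cases A a i with ⟨h, hs⟩ | ⟨h, hs⟩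
    · rw [if_neg fun h => hne hs (hs.trans h), Nat.sub_zero, if_pos h, hs]
    · rw [if_neg (by omega), hs]
  refine ⟨hs, ?_⟩
  rw [slideRow_lowerAt_add_two, hs]
  have hcases : (A (i + 2) (slideRow A a (i + 1) + 1) = A (i + 1) (slideRow A a (i + 1)) ∧
      slideRow A a (i + 2) = slideRow A a (i + 1) + 1) ∨
      (A (i + 2) (slideRow A a (i + 1) + 1) ≠ A (i + 1) (slideRow A a (i + 1)) ∧
        slideRow A a (i + 2) = slideRow A a (i + 1)) := slideRow_succ_cases A a (i + 1)
  rcases eq_or_ne (slideRow A a (i + 1)) p with hsp | hsp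
  · have hbelow := (hp.letters_of_rowHeight hA).2
    have hlt := hp.2 (p + 1) (by omega)
    obtain ⟨h, hr⟩ := (slideRow_succ_cases A a i).resolve_left fun h => hne h.2 hsp
    rw [← hr, hsp] at hstrip h
    rw [rowHeight_succ] at hlt
    rw [hsp] at hcases ⊢
    rw [if_pos rfl, if_neg (by omega)]
    omega
  · rw [if_neg hsp, Nat.sub_zero]
    rcases hcases with ⟨h, ht⟩ | ⟨h, ht⟩
    · rw [if_pos h, ht]
    · rw [if_neg h, ht]

theorem slideRow_lowerAt_of_eq (hA : IsGTPattern A) (hp : IsLastMax (rowHeight A i) p)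
    (hdown : slideRow A a (i + 1) = slideRow A a i + 1) (hs : slideRow A a (i + 1) = p) :
    slideRow (lowerAt A i p) a (i + 1) = slideRow A a i ∧
      slideRow (lowerAt A i p) a (i + 2) = p := by
  have hletter := (hp.letters_of_rowHeight hA).1
  have hle := hp.le (slideRow A a i)
  have hupper : A (i + 2) (slideRow A a i + 1) ≤ A (i + 1) (slideRow A a i) :=
    hA.strip (i + 1) (slideRow A a i)
  obtain rfl : slideRow A a i + 1 = p := by omega
  obtain ⟨h, -⟩ := (slideRow_succ_cases A a i).resolve_right fun h => by omega
  have hs' : slideRow (lowerAt A i (slideRow A a i + 1)) a (i + 1) = slideRow A a i := by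
    rw [slideRow_lowerAt_succ, if_pos rfl, if_neg (by omega)]
  rw [rowHeight_succ] at hle
  refine ⟨hs', ?_⟩
  rw [slideRow_lowerAt_add_two, hs', if_neg (show slideRow A a i ≠ slideRow A a i + 1 by omega),
    Nat.sub_zero, if_pos (by omega)]

theorem slidePattern_lowerAt {p' : ℕ}
    (hs : slideRow (lowerAt A i p) a (i + 1) = slideRow A a (i + 1) ∧ p' = p ∨
      slideRow (lowerAt A i p) a (i + 1) = p' ∧ slideRow A a (i + 1) = p)
    (ht : slideRow (lowerAt A i p) a (i + 2) = slideRow A a (i + 2)) :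
    slidePattern (lowerAt A i p) a = lowerAt (slidePattern A a) i p' := by
  funext k q
  rcases eq_or_ne k (i + 1) with rfl | hk
  · rw [lowerAt_succ, slidePattern, slidePattern, lowerAt_succ]
    rcases hs with ⟨hs, rfl⟩ | ⟨hs, hs'⟩
    · rw [hs, Nat.sub_right_comm]
    · rw [hs, hs', Nat.sub_right_comm]
  · have hrow : slideRow (lowerAt A i p) a k = slideRow A a k := by
      rcases hk.lt_or_gt with hk | hk
      · exact slideRow_lowerAt_of_le (by omega)
      · exact slideRow_congr_of_le ht (fun m hm => lowerAt_of_ne A p (by omega)) hk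
    rw [lowerAt_of_ne _ _ hk, slidePattern, slidePattern, lowerAt_of_ne _ _ hk, hrow]

theorem Lowers.slide (h : Lowers i A B) (ha : A 0 (a + 1) < A 0 a) :
    Lowers i (slidePattern A a) (slidePattern B a) ∧
      ∀ k, i + 2 ≤ k → slideRow B a k = slideRow A a k := by
  obtain ⟨hA, p, hp, rfl⟩ := h
  suffices h : ∃ p', IsLastMax (rowHeight (slidePattern A a) i) p' ∧
      slidePattern (lowerAt A i p) a = lowerAt (slidePattern A a) i p' ∧
      slideRow (lowerAt A i p) a (i + 2) = slideRow A a (i + 2) by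
    obtain ⟨p', hp', hB, ht⟩ := h
    exact ⟨⟨hA.slide ha, p', hp', hB⟩, fun k hk =>
      slideRow_congr_of_le ht (fun m hm => lowerAt_of_ne A p (by omega)) hk⟩
  by_cases hcase : slideRow A a (i + 1) = slideRow A a i + 1 ∧ slideRow A a (i + 1) = p
  · obtain ⟨hdown, hs⟩ := hcase
    obtain ⟨ht, hp'⟩ := hp.rowHeight_slidePattern_of_eq hA ha hdown hs
    obtain ⟨hs', ht'⟩ := slideRow_lowerAt_of_eq hA hp hdown hs
    replace ht' := ht'.trans ht.symm
    exact ⟨_, hp', slidePattern_lowerAt (Or.inr ⟨hs', hs⟩) ht', ht'⟩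
  · rw [not_and] at hcase
    obtain ⟨hs', ht'⟩ := slideRow_lowerAt_of_ne hA hp hcase
    exact ⟨p, hp.rowHeight_slidePattern_of_ne hA ha hcase,
      slidePattern_lowerAt (Or.inl ⟨hs', rfl⟩) ht', ht'⟩

end LowersSlide

/-! ### Switching of skew fillings -/

/-- The filling `S` is a semistandard tableau of the skew shape whose row `q` consists of the
squares `(q, j)` with `N q ≤ j < M q`. -/
structure IsSkewFilling (S : Filling) (N M : ℕ → ℕ) : Prop where
  anti : Antitone N
  le : ∀ q, N q ≤ M q
  ne_top_iff : ∀ q j, S (q, j) ≠ ⊤ ↔ N q ≤ j ∧ j < M q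
  row : ∀ q j, S (q, j) ≠ ⊤ → S (q, j) ≤ S (q, j + 1)
  col : ∀ q j, S (q, j) ≠ ⊤ → S (q, j) < S (q + 1, j)

section IsSkewFilling

variable {S : Filling} {N M : ℕ → ℕ} {a b : ℕ}

theorem isSkewFilling_fill {A : ℕ → ℕ → ℕ} {K : ℕ} (hA : IsGTPattern A)
    (hK : ∀ k, K ≤ k → A k = A K) : IsSkewFilling (fill A) (A 0) (A K) where
  anti := hA.antitone 0
  le q := hA.monotone q K.zero_le
  ne_top_iff _ _ := fill_ne_top_iff_of_stable hA hK
  row _ _ h := fill_le_of_le hA ((fill_ne_top_iff_of_stable hA hK).1 h).1 (Nat.le_succ _)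
  col _ _ h := fill_lt_of_lt hA ((fill_ne_top_iff_of_stable hA hK).1 h).1 h (Nat.lt_succ_self _)

theorem IsSkewFilling.eq_of_top (h : IsSkewFilling (fun _ => ⊤) N M) : M = N := by
  funext q
  have hempty := h.ne_top_iff q (N q)
  have hle := h.le q
  simp only [ne_eq, not_true_eq_false, le_refl, true_and, false_iff] at hempty
  omega

theorem IsSkewFilling.last (h : IsSkewFilling S N M) (hs : IsLastSquare S (a, b)) :
    M a = b + 1 ∧ M (a + 1) ≤ b := by
  obtain ⟨hne, hlast⟩ := hs
  obtain ⟨hN, hM⟩ := (h.ne_top_iff a b).1 hne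
  constructor
  · by_contra hright
    rcases hlast (a, b + 1) ((h.ne_top_iff ..).2 (by omega)) with hlt | ⟨-, hle⟩
    · exact hlt.not_ge (h.row a b hne)
    · exact absurd hle (Nat.not_succ_le_self b)
  · by_contra! hbelow
    have hanti := h.anti a.le_succ
    have hlt := h.col a b hne
    rcases hlast (a + 1, b) ((h.ne_top_iff ..).2 ⟨hanti.trans hN, hbelow⟩) with hlt' | ⟨heq, -⟩
    · exact hlt.not_gt hlt'
    · exact hlt.ne' heq

theorem IsSkewFilling.remove {M' : ℕ → ℕ} (h : IsSkewFilling S N M)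
    (hs : IsLastSquare S (a, b)) (hM' : ∀ q, M' q = M q - if q = a then 1 else 0) :
    IsSkewFilling (Function.update S (a, b) ⊤) N M' := by
  have hlast := h.last hs
  have hab := (h.ne_top_iff a b).1 hs.1
  have hne {s : ℕ × ℕ} (hs : Function.update S (a, b) ⊤ s ≠ ⊤) :
      Function.update S (a, b) ⊤ s = S s ∧ S s ≠ ⊤ := by
    rcases eq_or_ne s (a, b) with rfl | hs'
    · exact absurd (Function.update_self ..) hs
    · rw [Function.update_of_ne hs'] at hs ⊢
      exact ⟨rfl, hs⟩
  have hle (s : ℕ × ℕ) : S s ≤ Function.update S (a, b) ⊤ s := by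
    rw [Function.update_apply]
    split_ifs
    exacts [le_top, le_rfl]
  refine ⟨h.anti, fun q => ?_, fun q j => ?_, fun q j hq => ?_, fun q j hq => ?_⟩
  · have := h.le q
    rw [hM']
    split_ifs with hq
    · rw [hq]
      omega
    · omega
  · rw [hM']
    rcases eq_or_ne (q, j) (a, b) with hqj | hqj
    · obtain ⟨rfl, rfl⟩ := Prod.mk.inj hqj
      rw [Function.update_self, if_pos rfl]
      exact iff_of_false (· rfl) (by omega)
    · rw [Function.update_of_ne hqj, h.ne_top_iff]
      rw [ne_eq, Prod.mk_inj] at hqj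
      split_ifs with hq
      · subst hq
        omega
      · rfl
  · exact ((hne hq).1.trans_le (h.row _ _ (hne hq).2)).trans (hle _)
  · exact ((hne hq).1.trans_lt (h.col _ _ (hne hq).2)).trans_le (hle _)

end IsSkewFilling

/-- A partial operation on patterns, given by the relation `R A B` between argument and value, that
is equivariant for slides: it does not change the inner shape and the outer shape, it is defined on
`A` if it is on a slide of `A`, and it commutes with slides, in which the empty square finally
follows the same rows. -/
structure SlideEquivariant (R : (ℕ → ℕ → ℕ) → (ℕ → ℕ → ℕ) → Prop) : Prop where
  isGTPattern : ∀ {A B}, R A B → IsGTPattern B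
  unique : ∀ {A B C}, R A B → R A C → B = C
  zero_eq : ∀ {A B}, R A B → B 0 = A 0
  eventually_eq : ∀ {A B}, R A B → ∃ K, ∀ k, K ≤ k → B k = A k
  exists_of_slide : ∀ {A a}, IsGTPattern A → A 0 (a + 1) < A 0 a →
    (∃ B, R (slidePattern A a) B) → ∃ B, R A B
  slide : ∀ {A B a}, R A B → A 0 (a + 1) < A 0 a → R (slidePattern A a) (slidePattern B a)
  eventually_slideRow_eq : ∀ {A B a}, R A B → A 0 (a + 1) < A 0 a →
    ∃ K, ∀ k, K ≤ k → slideRow B a k = slideRow A a k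

theorem slideEquivariant_lowers (i : ℕ) : SlideEquivariant (Lowers i) where
  isGTPattern h := h.isGTPattern
  unique h h' := h.unique h'
  zero_eq h := h.eq_of_ne (by omega)
  eventually_eq h := ⟨i + 2, fun k hk => h.eq_of_ne (by omega)⟩
  exists_of_slide hA ha := exists_lowers_of_slidePattern hA ha i
  slide h ha := (h.slide ha).1
  eventually_slideRow_eq h ha := ⟨i + 2, (h.slide ha).2⟩

theorem slideEquivariant_raises (i : ℕ) : SlideEquivariant fun A B => Lowers i B A where
  isGTPattern h := h.1
  unique h h' := h.unique_left h'
  zero_eq h := (h.eq_of_ne (by omega)).symm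
  eventually_eq h := ⟨i + 2, fun k hk => (h.eq_of_ne (by omega)).symm⟩
  exists_of_slide hA ha := exists_raises_of_slidePattern hA ha i
  slide h ha := (h.slide (h.eq_of_ne (k := 0) (by omega) ▸ ha)).1
  eventually_slideRow_eq h ha := ⟨i + 2, fun k hk =>
    ((h.slide (h.eq_of_ne (k := 0) (by omega) ▸ ha)).2 k hk).symm⟩

section Switching

variable {R : (ℕ → ℕ → ℕ) → (ℕ → ℕ → ℕ) → Prop} {A B : ℕ → ℕ → ℕ} {a : ℕ}

theorem SlideEquivariant.slide_fill (hR : SlideEquivariant R) (h : R A B) (hA : IsGTPattern A)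
    (ha : A 0 (a + 1) < A 0 a) {T' : Filling} {t : ℕ × ℕ}
    (hslide : Slide (fill A) (a, A 0 a - 1) T' t) :
    Slide (fill B) (a, A 0 a - 1) (fill (slidePattern B a)) t := by
  obtain ⟨K₁, hK₁⟩ := hA.stable
  obtain ⟨K₂, hK₂⟩ := hR.eventually_eq h
  obtain ⟨K₃, hK₃⟩ := hR.eventually_slideRow_eq h ha
  obtain ⟨K, hKK₁, hKK₂, hKK₃⟩ : ∃ K, K₁ ≤ K ∧ K₂ ≤ K ∧ K₃ ≤ K :=
    ⟨K₁ + K₂ + K₃, by omega, by omega, by omega⟩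
  have hAK (k : ℕ) (hk : K ≤ k) : A k = A K := by rw [hK₁ k (by omega), hK₁ K hKK₁]
  have hBK (k : ℕ) (hk : K ≤ k) : B k = B K := by
    rw [hK₂ k (by omega), hK₂ K hKK₂, hAK k hk]
  have hslideA := _root_.slide_fill hA ha hAK
  have hslideB := _root_.slide_fill (hR.isGTPattern h) (by rwa [hR.zero_eq h]) hBK
  rw [hR.zero_eq h, hK₂ K hKK₂, hK₃ K hKK₃, ← (hslide.unique hslideA).2] at hslideB
  exact hslideB

theorem SlideEquivariant.exists_switch (hR : SlideEquivariant R) {S T T' S' : Filling}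
    (h : FillingSwitch S T T' S') {N : ℕ → ℕ} (hA : IsGTPattern A) (hT : T = fill A)
    (hS : IsSkewFilling S N (A 0)) :
    ∃ A', IsGTPattern A' ∧ T' = fill A' ∧ A' 0 = N ∧ ((∃ B', R A' B') → ∃ B, R A B) ∧
      ∀ B, R A B → ∃ B', R A' B' ∧ FillingSwitch S (fill B) (fill B') S' := by
  induction h generalizing A N with
  | nil T => exact ⟨A, hA, hT, hS.eq_of_top, id, fun B hB => ⟨B, hB, FillingSwitch.nil _⟩⟩
  | step S T T₁ T' S' s t hs hslide rest ih =>
    obtain ⟨a, b⟩ := s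
    obtain ⟨hb, hcorner⟩ := hS.last hs
    have ha : A 0 (a + 1) < A 0 a := by omega
    obtain rfl : A 0 a - 1 = b := by omega
    subst hT
    obtain ⟨K, hK⟩ := hA.stable
    obtain ⟨A', hA', hT', hN, hexists, hcomm⟩ := ih (hA.slide ha)
      (hslide.unique (_root_.slide_fill hA ha hK)).1 (hS.remove hs fun q => rfl)
    refine ⟨A', hA', hT', hN, fun h => hR.exists_of_slide hA ha (hexists h), fun B hB => ?_⟩
    obtain ⟨B', hB', hswitch⟩ := hcomm _ (hR.slide hB ha)
    exact ⟨B', hB', .step _ _ _ _ _ _ _ hs (hR.slide_fill hB hA ha hslide) hswitch⟩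

end Switching

/-! ### Tableaux as patterns -/

namespace SkewTableau

variable {lam mu : YoungDiagram} {i k p q j : ℕ}

theorem exists_not_lt_pattern (T : SkewTableau lam mu) (k q : ℕ) :
    ∃ j, ¬ (j < lam.rowLen q ∧ (j < mu.rowLen q ∨ T.entry (q, j) < k)) :=
  ⟨lam.rowLen q, fun h => lt_irrefl _ h.1⟩

/-- The Gelfand–Tsetlin pattern of a skew tableau: the number of squares of row `q` that lie in the
inner shape or have an entry smaller than `k`, encoded as the first column that does not. -/
def pattern (T : SkewTableau lam mu) (k q : ℕ) : ℕ :=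
  Nat.find (T.exists_not_lt_pattern k q)

theorem lt_pattern_iff (T : SkewTableau lam mu) :
    j < T.pattern k q ↔ j < lam.rowLen q ∧ (j < mu.rowLen q ∨ T.entry (q, j) < k) := by
  rw [pattern, Nat.lt_find_iff]
  simp only [not_not]
  refine ⟨fun h => h j le_rfl, fun ⟨hlam, h⟩ m hm => ⟨hm.trans_lt hlam, ?_⟩⟩
  rcases lt_or_ge m (mu.rowLen q) with hmu | hmu
  · exact Or.inl hmu
  · have hle := T.row_weak q m j hm (by rwa [YoungDiagram.mem_iff_lt_rowLen, not_lt])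
      (YoungDiagram.mem_iff_lt_rowLen.2 hlam)
    omega

theorem mem_and_entry_eq_iff (T : SkewTableau lam mu) :
    ((q, j) ∈ lam ∧ (q, j) ∉ mu) ∧ T.entry (q, j) = k ↔
      T.pattern k q ≤ j ∧ j < T.pattern (k + 1) q := by
  rw [← not_lt, lt_pattern_iff, lt_pattern_iff, YoungDiagram.mem_iff_lt_rowLen,
    YoungDiagram.mem_iff_lt_rowLen]
  omega

theorem pattern_zero (T : SkewTableau lam mu) : T.pattern 0 = mu.rowLen := by
  funext q
  refine eq_of_forall_lt_iff fun j => ?_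
  rw [lt_pattern_iff, ← YoungDiagram.mem_iff_lt_rowLen, ← YoungDiagram.mem_iff_lt_rowLen]
  have := @T.le (q, j)
  tauto

theorem exists_pattern_eq (T : SkewTableau lam mu) :
    ∃ K, ∀ k, K ≤ k → T.pattern k = lam.rowLen := by
  refine ⟨lam.cells.sup T.entry + 1, fun k hk => funext fun q => ?_⟩
  refine eq_of_forall_lt_iff fun j => ?_
  rw [lt_pattern_iff, and_iff_left_iff_imp, ← YoungDiagram.mem_iff_lt_rowLen]
  intro hj
  have : T.entry (q, j) ≤ lam.cells.sup T.entry := Finset.le_sup ((YoungDiagram.mem_cells _).2 hj)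
  omega

theorem isGTPattern (T : SkewTableau lam mu) : IsGTPattern T.pattern where
  mono k q := by
    refine le_of_forall_lt fun j hj => ?_
    rw [lt_pattern_iff] at hj ⊢
    omega
  strip k q := by
    refine le_of_forall_lt fun j hj => ?_
    rw [lt_pattern_iff] at hj ⊢
    have hlam := lam.rowLen_anti q (q + 1) q.le_succ
    have hmu := mu.rowLen_anti q (q + 1) q.le_succ
    have hcol := T.col_strict q (q + 1) j q.lt_succ_self
    rw [YoungDiagram.mem_iff_lt_rowLen, YoungDiagram.mem_iff_lt_rowLen] at hcol
    omega
  stable := by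
    obtain ⟨K, hK⟩ := T.exists_pattern_eq
    exact ⟨K, fun k hk => by rw [hK k hk, hK K le_rfl]⟩
  supp k := by
    refine ⟨lam.colLen 0, fun q hq => Nat.eq_zero_of_not_pos fun hpos => hq.not_gt ?_⟩
    rw [← YoungDiagram.mem_iff_lt_colLen, YoungDiagram.mem_iff_lt_rowLen]
    exact (T.lt_pattern_iff.1 hpos).1

theorem filling_eq_fill (T : SkewTableau lam mu) : T.filling = fill T.pattern := by
  funext ⟨q, j⟩
  by_cases hmem : (q, j) ∈ lam ∧ (q, j) ∉ mu
  · rw [filling, if_pos hmem, (fill_eq_natCast_iff T.isGTPattern).2]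
    exact T.mem_and_entry_eq_iff.1 ⟨hmem, rfl⟩
  · rw [filling, if_neg hmem]
    by_contra! hne
    obtain ⟨k, hk⟩ := (fill_ne_top_iff T.isGTPattern).1 hne.symm
    exact hmem (T.mem_and_entry_eq_iff.2 hk).1

theorem isSkewFilling (T : SkewTableau lam mu) :
    IsSkewFilling T.filling mu.rowLen lam.rowLen := by
  obtain ⟨K, hK⟩ := T.exists_pattern_eq
  rw [T.filling_eq_fill, ← T.pattern_zero, ← hK K le_rfl]
  exact isSkewFilling_fill T.isGTPattern fun k hk => by rw [hK k hk, hK K le_rfl]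

theorem mem_iff_fill_ne_top {B : ℕ → ℕ → ℕ} (hB : IsGTPattern B) (hzero : B 0 = mu.rowLen)
    {K : ℕ} (hK : ∀ k, K ≤ k → B k = lam.rowLen) (s : ℕ × ℕ) :
    s ∈ lam ∧ s ∉ mu ↔ fill B s ≠ ⊤ := by
  rw [fill_ne_top_iff_of_stable hB fun k hk => by rw [hK k hk, hK K le_rfl], hzero, hK K le_rfl,
    YoungDiagram.mem_iff_lt_rowLen, YoungDiagram.mem_iff_lt_rowLen, not_lt, and_comm]

theorem exists_filling_eq_fill {B : ℕ → ℕ → ℕ} (hB : IsGTPattern B) (hzero : B 0 = mu.rowLen)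
    {K : ℕ} (hK : ∀ k, K ≤ k → B k = lam.rowLen) :
    ∃ U : SkewTableau lam mu, U.filling = fill B := by
  have hmem := mem_iff_fill_ne_top hB hzero hK
  have hentry {s : ℕ × ℕ} (hs : s ∈ lam ∧ s ∉ mu) :
      (((fill B s).untopD 0 : ℕ) : WithTop ℕ) = fill B s := by
    obtain ⟨k, hk⟩ := WithTop.ne_top_iff_exists.1 ((hmem s).1 hs)
    rw [← hk]
    rfl
  have hzero_le {q j : ℕ} (h : (q, j) ∉ mu) : B 0 q ≤ j := by
    rwa [YoungDiagram.mem_iff_lt_rowLen, ← hzero, not_lt] at h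
  refine ⟨
    { le := fun ⟨q, j⟩ h => ?_
      entry := fun s => (fill B s).untopD 0
      row_weak := fun q j₁ j₂ hj h₁ h₂ => ?_
      col_strict := fun q₁ q₂ j hq h₁ h₂ => ?_
      zeros := fun s hs => by rw [not_not.1 (mt (hmem s).2 hs), WithTop.untopD_top] },
    funext fun s => ?_⟩
  · rw [YoungDiagram.mem_iff_lt_rowLen] at h ⊢
    rw [← hK K le_rfl]
    exact (hzero ▸ h).trans_le (hB.monotone q K.zero_le)
  · rw [← Nat.cast_le (α := WithTop ℕ), hentry ⟨lam.up_left_mem le_rfl hj h₂, h₁⟩,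
      hentry ⟨h₂, fun h => h₁ (mu.up_left_mem le_rfl hj h)⟩]
    exact fill_le_of_le hB (hzero_le h₁) hj
  · have hs : (q₁, j) ∈ lam ∧ (q₁, j) ∉ mu := ⟨lam.up_left_mem hq.le le_rfl h₂, h₁⟩
    rw [← Nat.cast_lt (α := WithTop ℕ), hentry hs,
      hentry ⟨h₂, fun h => h₁ (mu.up_left_mem hq.le le_rfl h)⟩]
    exact fill_lt_of_lt hB (hzero_le h₁) ((hmem _).1 hs) hq
  · by_cases hs : s ∈ lam ∧ s ∉ mu
    · rw [filling, if_pos hs, hentry hs]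
    · rw [filling, if_neg hs, not_not.1 (mt (hmem s).2 hs)]

theorem exists_pattern_eq_of_isGTPattern {B : ℕ → ℕ → ℕ} (hB : IsGTPattern B)
    (hzero : B 0 = mu.rowLen) {K : ℕ} (hK : ∀ k, K ≤ k → B k = lam.rowLen) :
    ∃ U : SkewTableau lam mu, U.pattern = B := by
  obtain ⟨U, hU⟩ := exists_filling_eq_fill hB hzero hK
  exact ⟨U, eq_of_fill_eq U.isGTPattern hB (by rw [U.pattern_zero, hzero])
    (U.filling_eq_fill.symm.trans hU)⟩

section Update

variable {T U : SkewTableau lam mu} {c : ℕ}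

theorem pattern_succ_of_entry_eq_update (hs : (p, c) ∈ lam ∧ (p, c) ∉ mu)
    (hT : T.entry (p, c) = i) (hU : U.entry = Function.update T.entry (p, c) (i + 1)) :
    T.pattern (i + 1) p = c + 1 := by
  refine le_antisymm (le_of_not_gt fun hlt => ?_) (T.mem_and_entry_eq_iff.1 ⟨hs, hT⟩).2
  obtain ⟨hlam, h⟩ := T.lt_pattern_iff.1 hlt
  have hrow := U.row_weak p c (c + 1) c.le_succ hs.2 (YoungDiagram.mem_iff_lt_rowLen.2 hlam)
  have hmu := YoungDiagram.mem_iff_lt_rowLen.not.1 hs.2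
  rw [hU, Function.update_self, Function.update_of_ne (by simp)] at hrow
  omega

theorem pattern_eq_lowerAt_of_entry_eq_update (hs : (p, c) ∈ lam ∧ (p, c) ∉ mu)
    (hT : T.entry (p, c) = i) (hU : U.entry = Function.update T.entry (p, c) (i + 1)) :
    U.pattern = lowerAt T.pattern i p := by
  have hsucc := pattern_succ_of_entry_eq_update hs hT hU
  rw [YoungDiagram.mem_iff_lt_rowLen, YoungDiagram.mem_iff_lt_rowLen] at hs
  funext k q
  refine eq_of_forall_lt_iff fun j => ?_
  have hlt := T.lt_pattern_iff (k := k) (q := q) (j := j)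
  rw [U.lt_pattern_iff, hU]
  rcases eq_or_ne (q, j) (p, c) with hqj | hqj
  · obtain ⟨rfl, rfl⟩ := Prod.mk.inj hqj
    rw [Function.update_self]
    rcases eq_or_ne k (i + 1) with rfl | hk
    · rw [lowerAt_succ, if_pos rfl]
      omega
    · rw [lowerAt_of_ne _ _ hk]
      omega
  · rw [Function.update_of_ne hqj, ← hlt]
    rw [ne_eq, Prod.mk_inj] at hqj
    rcases eq_or_ne k (i + 1) with rfl | hk
    · rw [lowerAt_succ]
      split_ifs with hq
      · subst hq
        omega
      · rfl
    · rw [lowerAt_of_ne _ _ hk]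

theorem entry_eq_update_of_pattern_eq_lowerAt (hletter : T.pattern i p < T.pattern (i + 1) p)
    (hU : U.pattern = lowerAt T.pattern i p) :
    U.entry = Function.update T.entry (p, T.pattern (i + 1) p - 1) (i + 1) := by
  funext ⟨q, j⟩
  rcases eq_or_ne (q, j) (p, T.pattern (i + 1) p - 1) with hqj | hqj
  · obtain ⟨rfl, rfl⟩ := Prod.mk.inj hqj
    have hmono := T.isGTPattern.mono (i + 1) q
    rw [Function.update_self]
    refine (U.mem_and_entry_eq_iff.2 ?_).2
    rw [hU, lowerAt_succ, if_pos rfl, lowerAt_of_ne _ _ (by omega)]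
    omega
  rw [Function.update_of_ne hqj]
  by_cases hmem : (q, j) ∈ lam ∧ (q, j) ∉ mu
  · obtain ⟨hle, hlt⟩ := T.mem_and_entry_eq_iff.1 ⟨hmem, rfl⟩
    refine (U.mem_and_entry_eq_iff.2 ⟨?_, ?_⟩).2
    · rw [hU, lowerAt, Function.update_apply]
      split_ifs with hk
      · exact (Nat.sub_le ..).trans (hk ▸ hle)
      · exact hle
    · rw [hU, lowerAt, Function.update_apply]
      split_ifs with hk
      · rw [hk] at hlt
        dsimp only
        split_ifs with hq
        · subst hq
          rw [ne_eq, Prod.mk_inj] at hqj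
          omega
        · exact hlt
      · exact hlt
  · rw [T.zeros _ hmem, U.zeros _ hmem]

end Update

end SkewTableau

/-! ### Heights of words -/

/-- The number of letters `i + 1` minus the number of letters `i` in the prefix of length `n` of the
word `w`. The operation `f_i` changes the letter that follows the longest prefix of maximal
height. -/
def height (i : ℕ) (w : List ℕ) (n : ℕ) : ℤ :=
  (w.take n).count (i + 1) - (w.take n).count i

section Words

variable {i n : ℕ} {u v w w' : List ℕ}

theorem height_of_length_le (hn : w.length ≤ n) : height i w n = height i w w.length := by
  rw [height, height, List.take_of_length_le hn, List.take_length]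

theorem height_append_of_le (hn : n ≤ u.length) : height i (u ++ v) n = height i u n := by
  rw [height, height, List.take_append_of_le_length hn]

theorem height_append_add (i : ℕ) (u v : List ℕ) (n : ℕ) :
    height i (u ++ v) (u.length + n) = height i u u.length + height i v n := by
  simp only [height, List.take_length_add_append, List.count_append, List.take_length]
  push_cast
  ring

theorem height_cons_self_succ (i : ℕ) (v : List ℕ) (n : ℕ) :
    height i (i :: v) (n + 1) = height i v n - 1 := by
  rw [height, height, List.take_succ_cons, List.count_cons_self,
    List.count_cons_of_ne i.lt_succ_self.ne]
  push_cast
  ring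

theorem height_succ (i : ℕ) (hn : n < w.length) :
    height i w (n + 1) =
      height i w n + (if w[n] = i + 1 then 1 else 0) - (if w[n] = i then 1 else 0) := by
  rw [height, height, List.take_succ_eq_append_getElem hn]
  simp only [List.count_append, List.count_singleton, beq_iff_eq]
  push_cast
  ring

theorem dominant_iff : Dominant i w ↔ ∀ n, height i w n ≤ 0 := by
  simp only [Dominant, height, sub_nonpos, Nat.cast_le]
  refine ⟨fun h n => h _ (List.take_prefix n w), fun h u hu => ?_⟩
  rw [List.prefix_iff_eq_take.1 hu]
  exact h _

theorem antiDominant_iff : AntiDominant i w ↔ ∀ n, height i w n ≤ height i w w.length := by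
  have hdrop (n : ℕ) : height i w n ≤ height i w w.length ↔
      (w.drop n).count i ≤ (w.drop n).count (i + 1) := by
    have hcount (k : ℕ) : w.count k = (w.take n).count k + (w.drop n).count k := by
      rw [← List.count_append, List.take_append_drop]
    rw [height, height, List.take_length, hcount, hcount]
    omega
  simp only [hdrop]
  refine ⟨fun h n => h _ (List.drop_suffix n w), fun h u hu => ?_⟩
  rw [List.suffix_iff_eq_drop.1 hu]
  exact h _

theorem isLastMax_height_append_cons_iff :
    IsLastMax (height i (u ++ i :: v)) u.length ↔ AntiDominant i u ∧ Dominant i v := by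
  rw [antiDominant_iff, dominant_iff, IsLastMax, height_append_of_le le_rfl]
  have hbefore (n : ℕ) (hn : n ≤ u.length) := height_append_of_le (i := i) (v := i :: v) hn
  have hafter (n : ℕ) : height i (u ++ i :: v) (u.length + (n + 1)) =
      height i u u.length + (height i v n - 1) := by
    rw [height_append_add, height_cons_self_succ]
  refine and_congr ⟨fun h n => ?_, fun h n hn => (hbefore n hn.le).trans_le (h n)⟩
    ⟨fun h n => ?_, fun h n hn => ?_⟩
  · rcases lt_or_ge n u.length with hn | hn
    · exact (hbefore n hn.le).symm.trans_le (h n hn)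
    · exact (height_of_length_le hn).le
  · have := h (u.length + (n + 1)) (by omega)
    rw [hafter] at this
    omega
  · obtain ⟨m, rfl⟩ := Nat.exists_eq_add_of_lt hn
    have := h m
    rw [add_assoc, hafter]
    omega

theorem IsLastMax.getElem_of_height (h : IsLastMax (height i w) n) :
    ∃ hn : n < w.length, w[n] = i := by
  have hlt := h.2 (n + 1) n.lt_succ_self
  have hn : n < w.length := by
    by_contra! hn
    rw [height_of_length_le hn, height_of_length_le (hn.trans n.le_succ)] at hlt
    exact lt_irrefl _ hlt
  refine ⟨hn, ?_⟩
  by_contra hne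
  rw [height_succ i hn, if_neg hne] at hlt
  split_ifs at hlt <;> omega

theorem coplacticStep_iff :
    CoplacticStep i w w' ↔ ∃ n, IsLastMax (height i w) n ∧ w' = w.set n (i + 1) := by
  constructor
  · rintro ⟨u, v, rfl, rfl, hu, hv⟩
    exact ⟨u.length, isLastMax_height_append_cons_iff.2 ⟨hu, hv⟩, by simp⟩
  · rintro ⟨n, h, rfl⟩
    obtain ⟨hn, hi⟩ := h.getElem_of_height
    have hw : w = w.take n ++ i :: w.drop (n + 1) := by
      rw [← hi, List.cons_getElem_drop_succ, List.take_append_drop]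
    have hlength : (w.take n).length = n := List.length_take_of_le hn.le
    have hmax : IsLastMax (height i (w.take n ++ i :: w.drop (n + 1))) (w.take n).length := by
      rwa [← hw, hlength]
    exact ⟨_, _, hw, List.set_eq_take_append_cons_drop.trans (if_pos hn),
      isLastMax_height_append_cons_iff.1 hmax⟩

end Words

/-! ### Reading words of tableaux -/

namespace SkewTableau

variable {lam mu : YoungDiagram} {i k n q j : ℕ} {s t : ℕ × ℕ}

/-- The squares of the skew tableau `T` with entry `k`. -/
def letters (T : SkewTableau lam mu) (k : ℕ) : Finset (ℕ × ℕ) :=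
  lam.cells.filter fun s => s ∉ mu ∧ T.entry s = k

theorem entry_le_entry (T : SkewTableau lam mu) (hs : s ∉ mu) (ht : t ∈ lam) (hrow : s.1 ≤ t.1)
    (hcol : s.2 ≤ t.2) : T.entry s ≤ T.entry t := by
  have hmem : (t.1, s.2) ∈ lam := lam.up_left_mem le_rfl hcol ht
  have hnot : (t.1, s.2) ∉ mu := fun h => hs (mu.up_left_mem hrow le_rfl h)
  refine le_trans ?_ (T.row_weak t.1 s.2 t.2 hcol hnot ht)
  rcases hrow.eq_or_lt with h | h
  · rw [← h]
  · exact (T.col_strict s.1 t.1 s.2 h hs hmem).le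

theorem entry_lt_entry (T : SkewTableau lam mu) (hs : s ∉ mu) (ht : t ∈ lam) (hrow : s.1 < t.1)
    (hcol : s.2 ≤ t.2) : T.entry s < T.entry t :=
  (T.col_strict s.1 (s.1 + 1) s.2 s.1.lt_succ_self hs (lam.up_left_mem hrow hcol ht)).trans_le
    (T.entry_le_entry (fun h => hs (mu.up_left_mem s.1.le_succ le_rfl h)) ht hrow hcol)

theorem mem_letters (T : SkewTableau lam mu) :
    s ∈ T.letters k ↔ (s ∈ lam ∧ s ∉ mu) ∧ T.entry s = k := by
  rw [letters, Finset.mem_filter, YoungDiagram.mem_cells, and_assoc]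

theorem mk_mem_letters (T : SkewTableau lam mu) :
    (q, j) ∈ T.letters k ↔ T.pattern k q ≤ j ∧ j < T.pattern (k + 1) q := by
  rw [mem_letters, mem_and_entry_eq_iff]

theorem below_mem_letters (T : SkewTableau lam mu) (ht : t ∈ T.letters i)
    (hs : s ∈ T.letters (i + 1)) (hrow : t.1 < s.1) (hcol : t.2 ≤ s.2) :
    (t.1 + 1, t.2) ∈ T.letters (i + 1) := by
  rw [mem_letters] at hs ht ⊢
  have hlam : (t.1 + 1, t.2) ∈ lam := lam.up_left_mem hrow hcol hs.1.1
  have hmu : (t.1 + 1, t.2) ∉ mu := fun h => ht.1.2 (mu.up_left_mem t.1.le_succ le_rfl h)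
  have hlt := T.entry_lt_entry ht.1.2 hlam t.1.lt_succ_self le_rfl
  have hle := T.entry_le_entry hmu hs.1.1 hrow hcol
  exact ⟨⟨hlam, hmu⟩, by omega⟩

theorem card_letters_filter_fst_lt (T : SkewTableau lam mu) (k n : ℕ) :
    (((T.letters k).filter (·.1 < n)).card : ℤ) =
      ∑ q ∈ Finset.range n, ((T.pattern (k + 1) q : ℤ) - T.pattern k q) := by
  rw [Finset.card_eq_sum_card_fiberwise (f := Prod.fst) (t := Finset.range n)
    (by intro s hs; simpa using (Finset.mem_filter.1 hs).2), Nat.cast_sum]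
  refine Finset.sum_congr rfl fun q hq => ?_
  have hrow : ((T.letters k).filter (·.1 < n)).filter (·.1 = q) =
      {q} ×ˢ Finset.Ico (T.pattern k q) (T.pattern (k + 1) q) := by
    ext ⟨q', j⟩
    simp only [Finset.mem_filter, mk_mem_letters, Finset.mem_product, Finset.mem_singleton,
      Finset.mem_Ico]
    have := Finset.mem_range.1 hq
    constructor
    · rintro ⟨⟨h, -⟩, rfl⟩
      exact ⟨rfl, h⟩
    · rintro ⟨rfl, h⟩
      exact ⟨⟨h, this⟩, rfl⟩
  rw [hrow, Finset.card_product, Finset.card_singleton, one_mul, Nat.card_Ico,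
    Nat.cast_sub (T.isGTPattern.mono k q)]

theorem rowHeight_pattern (T : SkewTableau lam mu) (i p : ℕ) :
    rowHeight T.pattern i p = (((T.letters (i + 1)).filter (·.1 < p + 1)).card : ℤ) -
      ((T.letters i).filter (·.1 < p)).card := by
  rw [card_letters_filter_fst_lt, card_letters_filter_fst_lt, rowHeight]

end SkewTableau

namespace ReadingOrder

variable {lam mu : YoungDiagram} {i n p : ℕ} {s t : ℕ × ℕ}

theorem idxOf_le_idxOf (r : ReadingOrder lam mu) (hs : s ∈ lam ∧ s ∉ mu) (hrow : s.1 ≤ t.1)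
    (hcol : t.2 ≤ s.2) : r.squares.idxOf s ≤ r.squares.idxOf t := by
  by_contra! hlt
  have hs' := List.idxOf_lt_length_of_mem ((r.mem_squares s).2 hs)
  have hvalid := List.pairwise_iff_getElem.1 r.valid _ _ (hlt.trans hs') hs' hlt
  rw [List.getElem_idxOf, List.getElem_idxOf] at hvalid
  exact hvalid ⟨hrow, hcol⟩

theorem idxOf_lt_idxOf (r : ReadingOrder lam mu) (hs : s ∈ lam ∧ s ∉ mu) (hne : s ≠ t)
    (hrow : s.1 ≤ t.1) (hcol : t.2 ≤ s.2) : r.squares.idxOf s < r.squares.idxOf t :=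
  (r.idxOf_le_idxOf hs hrow hcol).lt_of_ne
    (mt (List.idxOf_inj ((r.mem_squares s).2 hs)).1 hne)

theorem count_take_word (r : ReadingOrder lam mu) (T : SkewTableau lam mu) (k n : ℕ) :
    ((r.word T).take n).count k =
      ((T.letters k).filter (r.squares.idxOf · < n)).card := by
  have hnodup : (r.squares.take n).Nodup := r.nodup.sublist (List.take_sublist ..)
  rw [word, ← List.map_take, List.count, List.countP_map, List.countP_eq_length_filter,
    ← List.toFinset_card_of_nodup (hnodup.filter _)]
  congr 1
  ext s
  simp only [List.mem_toFinset, List.mem_filter, Finset.mem_filter, SkewTableau.mem_letters,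
    ← r.mem_squares, Function.comp_apply, beq_iff_eq]
  constructor
  · rintro ⟨hs, hk⟩
    have := List.mem_of_mem_take hs
    exact ⟨⟨this, hk⟩, (List.mem_take_iff_idxOf_lt this).1 hs⟩
  · rintro ⟨⟨hs, hk⟩, hn⟩
    exact ⟨(List.mem_take_iff_idxOf_lt hs).2 hn, hk⟩

theorem height_word (r : ReadingOrder lam mu) (T : SkewTableau lam mu) (i n : ℕ) :
    height i (r.word T) n =
      (((T.letters (i + 1)).filter (r.squares.idxOf · < n)).card : ℤ) -
        ((T.letters i).filter (r.squares.idxOf · < n)).card := by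
  rw [height, count_take_word, count_take_word]

theorem height_word_le_rowHeight_of_forall_le (r : ReadingOrder lam mu) (T : SkewTableau lam mu)
    (hs : s ∈ T.letters (i + 1)) (hn : r.squares.idxOf s < n)
    (hlowest : ∀ t ∈ T.letters (i + 1), r.squares.idxOf t < n → t.1 ≤ s.1) :
    height i (r.word T) n ≤ rowHeight T.pattern i s.1 := by
  rw [r.height_word, T.rowHeight_pattern]
  set early : Finset (ℕ × ℕ) := (T.letters i).filter (r.squares.idxOf · < n)
  set early' : Finset (ℕ × ℕ) := (T.letters (i + 1)).filter (r.squares.idxOf · < n)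
  set upper : Finset (ℕ × ℕ) := (T.letters i).filter (·.1 < s.1)
  set upper' : Finset (ℕ × ℕ) := (T.letters (i + 1)).filter (·.1 < s.1 + 1)
  have hsub : early' ⊆ upper' := fun t ht => by
    obtain ⟨ht, htn⟩ := Finset.mem_filter.1 ht
    exact Finset.mem_filter.2 ⟨ht, Nat.lt_succ_of_le (hlowest t ht htn)⟩
  have hbelow : (upper \ early).card ≤ (upper' \ early').card := by
    refine Finset.card_le_card_of_injOn (fun t => (t.1 + 1, t.2)) (fun t ht => ?_) fun t _ t' _ h =>
      Prod.ext (Nat.succ_injective (Prod.mk.inj h).1) (Prod.mk.inj h).2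
    obtain ⟨ht, hlate⟩ := Finset.mem_sdiff.1 ht
    obtain ⟨ht, hrow⟩ := Finset.mem_filter.1 ht
    have hn' : n ≤ r.squares.idxOf t := not_lt.1 fun h => hlate (Finset.mem_filter.2 ⟨ht, h⟩)
    have hcol : t.2 < s.2 := by
      by_contra! hcol
      have := r.idxOf_le_idxOf (T.mem_letters.1 ht).1 hrow.le hcol
      omega
    have hnext := r.idxOf_le_idxOf (t := (t.1 + 1, t.2)) (T.mem_letters.1 ht).1 t.1.le_succ le_rfl
    refine Finset.mem_sdiff.2 ⟨Finset.mem_filter.2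
      ⟨T.below_mem_letters ht hs hrow hcol.le, Nat.succ_lt_succ hrow⟩, fun h => ?_⟩
    exact hn'.not_gt (hnext.trans_lt (Finset.mem_filter.1 h).2)
  have := Finset.card_le_card_sdiff_add_card (s := upper) (t := early)
  have := Finset.card_sdiff_add_card_eq_card hsub
  omega

theorem height_word_lt_rowHeight_of_forall_le (r : ReadingOrder lam mu) (T : SkewTableau lam mu)
    (hs : s ∈ T.letters i) (hn : r.squares.idxOf s < n)
    (hlowest : ∀ t ∈ T.letters (i + 1), r.squares.idxOf t < n → t.1 ≤ s.1) :
    height i (r.word T) n < rowHeight T.pattern i s.1 := by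
  have hpos := T.mem_letters.1 hs
  have hsucc : ((T.letters (i + 1)).filter (r.squares.idxOf · < n)).card ≤
      ((T.letters (i + 1)).filter (·.1 < s.1 + 1)).card := by
    refine Finset.card_le_card fun t ht => ?_
    obtain ⟨ht, htn⟩ := Finset.mem_filter.1 ht
    exact Finset.mem_filter.2 ⟨ht, Nat.lt_succ_of_le (hlowest t ht htn)⟩
  have hself : ((T.letters i).filter (·.1 < s.1)).card <
      ((T.letters i).filter (r.squares.idxOf · < n)).card := by
    refine Finset.card_lt_card ⟨fun t ht => ?_, fun h => ?_⟩
    · obtain ⟨ht, hrow⟩ := Finset.mem_filter.1 ht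
      have ht' := T.mem_letters.1 ht
      have hcol : s.2 ≤ t.2 := by
        by_contra! hcol
        have := T.entry_lt_entry ht'.1.2 hpos.1.1 hrow hcol.le
        omega
      exact Finset.mem_filter.2 ⟨ht, (r.idxOf_le_idxOf ht'.1 hrow.le hcol).trans_lt hn⟩
    · exact lt_irrefl _ (Finset.mem_filter.1 (h (Finset.mem_filter.2 ⟨hs, hn⟩))).2
  rw [r.height_word, T.rowHeight_pattern]
  omega

theorem exists_height_word_le_rowHeight (r : ReadingOrder lam mu) (T : SkewTableau lam mu)
    (i n : ℕ) : ∃ q, height i (r.word T) n ≤ rowHeight T.pattern i q ∧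
      ∀ t ∈ T.letters (i + 1), r.squares.idxOf t < n → t.1 ≤ q := by
  rcases ((T.letters (i + 1)).filter (r.squares.idxOf · < n)).eq_empty_or_nonempty with h | h
  · refine ⟨0, ?_, fun t ht htn => ?_⟩
    · have := rowHeight_zero_nonneg T.isGTPattern i
      rw [r.height_word, h, Finset.card_empty]
      omega
    · exact absurd (Finset.mem_filter.2 ⟨ht, htn⟩) (h ▸ Finset.notMem_empty t)
  · obtain ⟨s, hs, hmax⟩ := Finset.exists_max_image _ Prod.fst h
    obtain ⟨hs, hn⟩ := Finset.mem_filter.1 hs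
    have hlowest (t : ℕ × ℕ) (ht : t ∈ T.letters (i + 1)) (htn : r.squares.idxOf t < n) :
        t.1 ≤ s.1 := hmax t (Finset.mem_filter.2 ⟨ht, htn⟩)
    exact ⟨s.1, r.height_word_le_rowHeight_of_forall_le T hs hn hlowest, hlowest⟩

theorem height_word_idxOf (r : ReadingOrder lam mu) (T : SkewTableau lam mu)
    (hs : s ∈ T.letters i) (hlast : T.pattern (i + 1) s.1 = s.2 + 1) :
    height i (r.word T) (r.squares.idxOf s) = rowHeight T.pattern i s.1 := by
  have hpos := T.mem_letters.1 hs
  rw [r.height_word, T.rowHeight_pattern]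
  have hA := T.isGTPattern
  congr 3 <;> refine Finset.filter_congr fun t ht => ⟨fun h => ?_, fun h => ?_⟩ <;>
    have htpos := T.mem_letters.1 ht <;> have htcol := (T.mk_mem_letters (q := t.1)).1 ht
  · by_contra! hrow
    have hanti : T.pattern (i + 2) t.1 ≤ T.pattern (i + 2) (s.1 + 1) := hA.antitone (i + 2) hrow
    have hstrip := hA.strip (i + 1) s.1
    exact h.not_ge (r.idxOf_le_idxOf hpos.1 (by omega) (by lia))
  · have hanti := hA.antitone (i + 1) (Nat.lt_succ_iff.1 h)
    exact r.idxOf_lt_idxOf htpos.1 (by rintro rfl; omega) (by omega) (by omega)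
  · by_contra! hrow
    have hanti := hA.antitone (i + 1) hrow
    exact h.not_ge (r.idxOf_le_idxOf hpos.1 hrow (by omega))
  · have hanti : T.pattern (i + 1) s.1 ≤ T.pattern (i + 1) (t.1 + 1) := hA.antitone (i + 1) h
    have hstrip := hA.strip i t.1
    exact r.idxOf_lt_idxOf htpos.1 (by rintro rfl; omega) h.le (by omega)

theorem eventually_rowHeight_eq_height_word (r : ReadingOrder lam mu) (T : SkewTableau lam mu)
    (i : ℕ) : ∀ᶠ q in Filter.atTop,
      rowHeight T.pattern i q = height i (r.word T) (r.word T).length := by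
  filter_upwards [Filter.eventually_ge_atTop (lam.colLen 0)] with q hq
  have hrow (s : ℕ × ℕ) (hs : s ∈ lam) : s.1 < q :=
    (YoungDiagram.mem_iff_lt_colLen.1 (lam.up_left_mem le_rfl (Nat.zero_le s.2) hs)).trans_le hq
  have hidx (s : ℕ × ℕ) (hs : s ∈ lam ∧ s ∉ mu) : r.squares.idxOf s < (r.word T).length := by
    rw [word, List.length_map]
    exact List.idxOf_lt_length_of_mem ((r.mem_squares s).2 hs)
  rw [r.height_word, T.rowHeight_pattern]
  congr 3 <;> refine Finset.filter_congr fun s hs => ?_ <;>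
    have hs := (T.mem_letters.1 hs).1 <;> have := hrow s hs.1
  · exact iff_of_true (by omega) (hidx s hs)
  · exact iff_of_true this (hidx s hs)

theorem isLastMax_height_word_of_isLastMax (r : ReadingOrder lam mu) (T : SkewTableau lam mu)
    (hs : s ∈ T.letters i) (hlast : T.pattern (i + 1) s.1 = s.2 + 1)
    (h : IsLastMax (rowHeight T.pattern i) s.1) :
    IsLastMax (height i (r.word T)) (r.squares.idxOf s) := by
  rw [IsLastMax, r.height_word_idxOf T hs hlast]
  refine ⟨fun n _ => ?_, fun n hn => ?_⟩ <;>
    obtain ⟨q, hq, hlowest⟩ := r.exists_height_word_le_rowHeight T i n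
  · exact hq.trans (h.le q)
  · rcases lt_or_ge s.1 q with hsq | hsq
    · exact hq.trans_lt (h.2 q hsq)
    · exact r.height_word_lt_rowHeight_of_forall_le T hs hn
        fun t ht htn => (hlowest t ht htn).trans hsq

theorem isLastMax_height_word_iff (r : ReadingOrder lam mu) (T : SkewTableau lam mu)
    (hs : s ∈ T.letters i) (hlast : T.pattern (i + 1) s.1 = s.2 + 1) :
    IsLastMax (height i (r.word T)) (r.squares.idxOf s) ↔
      IsLastMax (rowHeight T.pattern i) s.1 := by
  refine ⟨fun h => ?_, r.isLastMax_height_word_of_isLastMax T hs hlast⟩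
  obtain ⟨p, hp⟩ : ∃ p, IsLastMax (rowHeight T.pattern i) p := by
    refine exists_isLastMax (q := s.1) ?_
    filter_upwards [r.eventually_rowHeight_eq_height_word T i] with q hq
    rw [hq, ← r.height_word_idxOf T hs hlast]
    exact h.2 _ h.getElem_of_height.1
  have hletter := (hp.letters_of_rowHeight T.isGTPattern).1
  obtain ⟨c, hc⟩ := Nat.exists_eq_add_of_lt hletter
  have hmem : (p, T.pattern i p + c) ∈ T.letters i := T.mk_mem_letters.2 (by omega)
  have hidx := (r.isLastMax_height_word_of_isLastMax T hmem hc hp).unique h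
  have heq : (p, T.pattern i p + c) = s :=
    (List.idxOf_inj ((r.mem_squares _).2 (T.mem_letters.1 hmem).1)).1 hidx
  rwa [← heq]

theorem word_eq_set_iff (r : ReadingOrder lam mu) {T U : SkewTableau lam mu}
    (hs : s ∈ lam ∧ s ∉ mu) (k : ℕ) :
    r.word U = (r.word T).set (r.squares.idxOf s) k ↔ U.entry = Function.update T.entry s k := by
  have hmem := (r.mem_squares s).2 hs
  have hupdate : r.squares.map (Function.update T.entry s k) =
      (r.word T).set (r.squares.idxOf s) k := by
    rw [r.nodup.map_update, if_pos hmem, word]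
    congr!
  rw [← hupdate, word, List.map_inj_left]
  refine ⟨fun h => funext fun t => ?_, fun h t _ => congrFun h t⟩
  by_cases ht : t ∈ lam ∧ t ∉ mu
  · exact h t ((r.mem_squares t).2 ht)
  · rw [Function.update_of_ne (by rintro rfl; exact ht hs), U.zeros t ht, T.zeros t ht]

end ReadingOrder

theorem isLower_iff {lam mu : YoungDiagram} (r : ReadingOrder lam mu) (i : ℕ)
    (T U : SkewTableau lam mu) : IsLower r i T U ↔ Lowers i T.pattern U.pattern := by
  rw [IsLower, coplacticStep_iff]
  constructor
  · rintro ⟨n, hn, hU⟩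
    obtain ⟨hlt, hentry⟩ := hn.getElem_of_height
    have hlt' : n < r.squares.length := by rwa [ReadingOrder.word, List.length_map] at hlt
    obtain ⟨s, rfl⟩ : ∃ s, n = r.squares.idxOf s := ⟨_, (r.nodup.idxOf_getElem n hlt').symm⟩
    have hs := (r.mem_squares s).1 (List.idxOf_lt_length_iff.1 hlt')
    simp only [ReadingOrder.word, List.getElem_map, List.getElem_idxOf] at hentry
    rw [r.word_eq_set_iff hs] at hU
    exact ⟨T.isGTPattern, s.1, (r.isLastMax_height_word_iff T (T.mem_letters.2 ⟨hs, hentry⟩)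
      (SkewTableau.pattern_succ_of_entry_eq_update hs hentry hU)).1 hn,
      SkewTableau.pattern_eq_lowerAt_of_entry_eq_update hs hentry hU⟩
  · rintro ⟨-, p, hp, hU⟩
    have hletter := (hp.letters_of_rowHeight T.isGTPattern).1
    have hs : (p, T.pattern (i + 1) p - 1) ∈ T.letters i := T.mk_mem_letters.2 (by omega)
    have hlast : T.pattern (i + 1) p = T.pattern (i + 1) p - 1 + 1 := by omega
    exact ⟨_, (r.isLastMax_height_word_iff T hs hlast).2 hp,
      (r.word_eq_set_iff (T.mem_letters.1 hs).1 (i + 1)).2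
        (SkewTableau.entry_eq_update_of_pattern_eq_lowerAt hletter hU)⟩

theorem isRaise_iff {lam mu : YoungDiagram} (r : ReadingOrder lam mu) (i : ℕ)
    (T U : SkewTableau lam mu) : IsRaise r i T U ↔ Lowers i U.pattern T.pattern :=
  isLower_iff r i U T

/-! ### Coplactic operations and switching -/

theorem SlideEquivariant.exists_pattern_eq {R : (ℕ → ℕ → ℕ) → (ℕ → ℕ → ℕ) → Prop}
    (hR : SlideEquivariant R) {lam mu : YoungDiagram} {T : SkewTableau lam mu} {B : ℕ → ℕ → ℕ}
    (h : R T.pattern B) : ∃ U : SkewTableau lam mu, U.pattern = B := by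
  obtain ⟨K, hK⟩ := T.exists_pattern_eq
  obtain ⟨L, hL⟩ := hR.eventually_eq h
  exact SkewTableau.exists_pattern_eq_of_isGTPattern (hR.isGTPattern h)
    ((hR.zero_eq h).trans T.pattern_zero) (K := max K L) fun k hk =>
      (hL k (le_of_max_le_right hk)).trans (hK k (le_of_max_le_left hk))

theorem IsSwitch.of_slideEquivariant {R : (ℕ → ℕ → ℕ) → (ℕ → ℕ → ℕ) → Prop}
    (hR : SlideEquivariant R) {nu mu mu' lam : YoungDiagram} {S : SkewTableau mu nu}
    {T : SkewTableau lam mu} {T' : SkewTableau mu' nu} {S' : SkewTableau lam mu'}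
    (hX : IsSwitch S T T' S') :
    ((∃ U : SkewTableau lam mu, R T.pattern U.pattern) ↔
        ∃ U' : SkewTableau mu' nu, R T'.pattern U'.pattern) ∧
      ∀ (U : SkewTableau lam mu) (U' : SkewTableau mu' nu), R T.pattern U.pattern →
        R T'.pattern U'.pattern → IsSwitch S U U' S' := by
  obtain ⟨A', hA', hT', hzero, hback, hforward⟩ :=
    hR.exists_switch hX T.isGTPattern T.filling_eq_fill (T.pattern_zero ▸ S.isSkewFilling)
  obtain rfl : T'.pattern = A' := eq_of_fill_eq T'.isGTPattern hA'
    (T'.pattern_zero.trans hzero.symm) (T'.filling_eq_fill.symm.trans hT')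
  refine ⟨⟨fun ⟨U, hU⟩ => ?_, fun ⟨U', hU'⟩ => ?_⟩, fun U U' hU hU' => ?_⟩
  · obtain ⟨B', hB', -⟩ := hforward _ hU
    obtain ⟨U', rfl⟩ := hR.exists_pattern_eq hB'
    exact ⟨U', hB'⟩
  · obtain ⟨B, hB⟩ := hback ⟨_, hU'⟩
    obtain ⟨U, rfl⟩ := hR.exists_pattern_eq hB
    exact ⟨U, hB⟩
  · obtain ⟨B', hB', hswitch⟩ := hforward _ hU
    rwa [hR.unique hB' hU', ← U.filling_eq_fill, ← U'.filling_eq_fill] at hswitch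

theorem mainTheorem1 {nu mu mu' lam : YoungDiagram}
    (S : SkewTableau mu nu) (T : SkewTableau lam mu)
    (T' : SkewTableau mu' nu) (S' : SkewTableau lam mu')
    (hX : IsSwitch S T T' S') (i : ℕ)
    (r : ReadingOrder lam mu) (r' : ReadingOrder mu' nu) :
    (((∃ U, IsRaise r i T U) ↔ ∃ U', IsRaise r' i T' U') ∧
      ∀ U U', IsRaise r i T U → IsRaise r' i T' U' → IsSwitch S U U' S') ∧
    (((∃ U, IsLower r i T U) ↔ ∃ U', IsLower r' i T' U') ∧
      ∀ U U', IsLower r i T U → IsLower r' i T' U' → IsSwitch S U U' S') := by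
  simp only [isRaise_iff, isLower_iff]
  exact ⟨hX.of_slideEquivariant (slideEquivariant_raises i),
    hX.of_slideEquivariant (slideEquivariant_lowers i)⟩
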